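/- **Setting.** Let $\mathbb T^2=(\mathbb R/2\pi\mathbb Z)^2$, with Fourier coefficients $\widehat u(k)$, $k\in\mathbb Z^2$, of complex functions $u\in H^0:=L^2(\mathbb T^2)$. For real $s$ put $\|u\|_s=\big(\sum_{k\in\mathbb Z^2}(1+|k|)^{2s}|\widehat u(k)|^2\big)^{1/2}$ and write $u\in H^s$ if this is finite. For $\nu\in\mathbb R$, $\tau>0$ let $\mathfrak L=\nu\partial_{y_1}^2+(-\partial_{y_1}^2-\tau^2\partial_{y_2}^2)^{1/2}$ be the operator in $L^2(\mathbb T^2)$ with symbol $$L(k)=-\nu k_1^2+(k_1^2+\tau^2k_2^2)^{1/2},\qquad \widehat{\mathfrak Lu}(k)=L(k)\widehat u(k),\qquad D(\mathfrak L)=\Big\{u\in L^2:\ \sum_k L(k)^2|\widehat u(k)|^2<\infty\Big\}.$$ For $\nu_0>1$ let $\tau>0$ be determined by $\nu_0=(1+\tau^2)^{1/2}$, let $\mathfrak L_0$ be $\mathfrak L$ with $\nu=\nu_0$, and let $k_0=(1,1)$, $k_0^*=(-1,1)$. Let $(\ker\mathfrak L_0)^\perp$ be the orthogonal complement in $L^2$.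 For $u\in(\ker\mathfrak L_0)^\perp$, $(\mathfrak L-\varkappa)^{-1}u$ denotes the solution $v\in D(\mathfrak L)\cap(\ker\mathfrak L_0)^\perp$ of $(\mathfrak L-\varkappa)v=u$. Put $\mu_c=(1+\tau^2)^{-1/2}$ and $$\nu_1(\tau)=\frac1{4\mu_c^5}-\frac1{2\mu_c^4}+\frac1{2\mu_c^3}+\frac7{8\mu_c^2}-\frac1{4\mu_c}-\frac9{16(2-\mu_c)} .$$ Given $R,r_0>0$, consider functions $\tilde\nu_j,\tilde\varkappa_j:[0,r_0]\to\mathbb R$, $j\ge1$, such that for all $j\ge 1$ and all $\varepsilon,\varepsilon'\in[0,r_0]$ $$|\tilde\nu_j(\varepsilon)|+|\tilde\varkappa_j(\varepsilon)|\le R,\qquad |\tilde\nu_j(\varepsilon)-\tilde\nu_j(\varepsilon')|+|\tilde\varkappa_j(\varepsilon)-\tilde\varkappa_j(\varepsilon')|\le R|\varepsilon-\varepsilon'|,$$ $$|\tilde\nu_{j+1}(\varepsilon)-\tilde\nu_j(\varepsilon)|+|\tilde\varkappa_{j+1}(\varepsilon)-\tilde\varkappa_j(\varepsilon)|\le R\,2^{-j},$$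 and set $\nu_j(\varepsilon)=\nu_0-\varepsilon^2\nu_1(\tau)+\varepsilon^3\tilde\nu_j(\varepsilon)$, $\varkappa_j(\varepsilon)=\varepsilon^2\tilde\varkappa_j(\varepsilon)$. **Theorem 4.2.** For each $\alpha\in(0,1]$ there is a set $\mathfrak N_\alpha\subset(1,\infty)$ of full measure such that for every $\nu_0\in\mathfrak N_\alpha$ the following holds. (a) Zero is a non-trivial eigenvalue of $\mathfrak L_0$ (its kernel contains non-constant functions), and $$\ker\mathfrak L_0=\operatorname{span}\{1,\ e^{\pm ik_0\cdot Y},\ e^{\pm ik_0^*\cdot Y}\}.$$ Moreover there is $c>0$, depending only on $\alpha$ and $\nu_0$, such that for all real $s$ and all $u\in(\ker\mathfrak L_0)^\perp\cap H^s$ $$\|\mathfrak L_0^{-1}u\|_{s-(1+\alpha)/2}\le c\,\|u\|_s ;$$ here $\mathfrak L_0^{-1}u$ is unique, it exists whenever $s\ge(1+\alpha)/2$, and for $s<(1+\alpha)/2$ the estimate is asserted for those $u$ for which it exists in $L^2$. (b) Suppose in addition that $\alpha<1/78$, and let $R>0$. There is $c>0$, depending only on $\alpha$, $\nu_0$ and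 $R$, such that for all $r_0>0$ and all sequences $\tilde\nu_j,\tilde\varkappa_j$ as above there is a measurable set $\mathcal E\subset[0,r_0)$ with $$\frac2{r^2}\int_{[0,r]\cap\mathcal E}\varepsilon\,d\varepsilon\to1\quad\text{as } r\downarrow0,$$ and such that for all $\varepsilon\in\mathcal E$, all integers $j\ge1$, all real $s\ge1$, with $\nu=\nu_j(\varepsilon)$, $\varkappa=\varkappa_j(\varepsilon)$, and for all $u\in(\ker\mathfrak L_0)^\perp\cap H^s$, the element $(\mathfrak L-\varkappa)^{-1}u$ exists, is unique, and $$\|(\mathfrak L-\varkappa)^{-1}u\|_{s-1}\le c\,\|u\|_s .$$ -/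

import Mathlib

open MeasureTheory Filter Topology
open scoped ENNReal

noncomputable section

namespace SmallDivisor

/-! ### Doubly periodic functions

A doubly `2π`-periodic function of `Y = (y₁, y₂)` is written as a function on the torus
`UnitAddTorus (Fin 2) = (ℝ/ℤ)²` of the variable `x = Y / (2π)`; thus `exp (i k·Y)` is the
monomial `UnitAddTorus.mFourier k`, `k ∈ ℤ²`. -/

/-- The normalised Lebesgue (Haar) measure on the two-dimensional torus. -/
abbrev torusMeasure : Measure (UnitAddTorus (Fin 2)) :=
  Measure.pi fun _ : Fin 2 => AddCircle.haarAddCircle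

/-- The complex Hilbert space `H⁰` of square integrable doubly periodic functions. -/
abbrev L2 : Type := Lp ℂ 2 torusMeasure

/-- The Hilbert basis `exp (i k·Y)`, `k ∈ ℤ²`, of `L2`. -/
def expBasis : HilbertBasis (Fin 2 → ℤ) ℂ L2 := UnitAddTorus.mFourierBasis

/-- The function `Y ↦ exp (i k·Y)` as an element of `L2`. -/
def expFun (k : Fin 2 → ℤ) : L2 :=
  ContinuousMap.toLp (E := ℂ) 2 torusMeasure ℂ (UnitAddTorus.mFourier k)

/-- The `k`-th Fourier coefficient of `u`: the integral of `exp (-i k·Y) u` over the torus. -/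
def fourierCoef (u : L2) (k : Fin 2 → ℤ) : ℂ :=
  ∫ x, UnitAddTorus.mFourier (-k) x * u x ∂torusMeasure

theorem expBasis_apply (k : Fin 2 → ℤ) : expBasis k = expFun k :=
  congrFun (UnitAddTorus.coe_mFourierBasis (d := Fin 2)) k

theorem expBasis_repr (u : L2) (k : Fin 2 → ℤ) : expBasis.repr u k = fourierCoef u k :=
  UnitAddTorus.mFourierBasis_repr (d := Fin 2) u k

theorem fourierCoef_add (u v : L2) (k : Fin 2 → ℤ) :
    fourierCoef (u + v) k = fourierCoef u k + fourierCoef v k := by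
  simp only [← expBasis_repr, map_add, lp.coeFn_add, Pi.add_apply]

theorem fourierCoef_smul (c : ℂ) (u : L2) (k : Fin 2 → ℤ) :
    fourierCoef (c • u) k = c * fourierCoef u k := by
  simp only [← expBasis_repr, map_smul, lp.coeFn_smul, Pi.smul_apply, smul_eq_mul]

theorem fourierCoef_zero (k : Fin 2 → ℤ) : fourierCoef 0 k = 0 := by
  simp only [← expBasis_repr, map_zero, lp.coeFn_zero, Pi.zero_apply]

/-- The Euclidean length `|k|` of `k ∈ ℤ²`. -/
def freqLength (k : Fin 2 → ℤ) : ℝ := √((k 0 : ℝ) ^ 2 + (k 1 : ℝ) ^ 2)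

/-- `u` belongs to the Sobolev space `H^s` of doubly periodic functions. -/
def MemSobolev (s : ℝ) (u : L2) : Prop :=
  Summable fun k : Fin 2 → ℤ => (1 + freqLength k) ^ (2 * s) * ‖fourierCoef u k‖ ^ 2

/-- The Sobolev norm `‖u‖_s` (meaningful when `MemSobolev s u`). -/
def sobolevNorm (s : ℝ) (u : L2) : ℝ :=
  √(∑' k : Fin 2 → ℤ, (1 + freqLength k) ^ (2 * s) * ‖fourierCoef u k‖ ^ 2)

/-! ### The operator `𝔏 = ν ∂²/∂y₁² + (-∂²/∂y₁² - τ² ∂²/∂y₂²)^{1/2}` -/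

/-- The symbol `L(k) = -ν k₁² + (k₁² + τ² k₂²)^{1/2}`. -/
def symbolL (ν τ : ℝ) (k : Fin 2 → ℤ) : ℝ :=
  -ν * (k 0 : ℝ) ^ 2 + √((k 0 : ℝ) ^ 2 + τ ^ 2 * (k 1 : ℝ) ^ 2)

/-- The natural domain of `𝔏`: all `u ∈ L2` with `∑ L(k)² |û(k)|² < ∞`. -/
def InDomL (ν τ : ℝ) (u : L2) : Prop :=
  Summable fun k : Fin 2 → ℤ => symbolL ν τ k ^ 2 * ‖fourierCoef u k‖ ^ 2

/-- The sequence `L(k) û(k)`. -/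
def multSeq (ν τ : ℝ) (u : L2) (k : Fin 2 → ℤ) : ℂ := (symbolL ν τ k : ℂ) * fourierCoef u k

theorem inDomL_iff (ν τ : ℝ) (u : L2) :
    InDomL ν τ u ↔ Memℓp (E := fun _ : Fin 2 → ℤ => ℂ) (multSeq ν τ u) 2 := by
  rw [memℓp_gen_iff (by norm_num)]
  refine summable_congr fun k => ?_
  simp [multSeq, mul_pow]

theorem multSeq_add (ν τ : ℝ) (u v : L2) :
    multSeq ν τ (u + v) = multSeq ν τ u + multSeq ν τ v := by
  funext k
  simp [multSeq, fourierCoef_add, mul_add]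

theorem multSeq_smul (ν τ : ℝ) (c : ℂ) (u : L2) :
    multSeq ν τ (c • u) = c • multSeq ν τ u := by
  funext k
  simp only [multSeq, fourierCoef_smul, Pi.smul_apply, smul_eq_mul]
  ring

/-- The domain of `𝔏` as a subspace of `L2`. -/
def domL (ν τ : ℝ) : Submodule ℂ L2 where
  carrier := {u | InDomL ν τ u}
  zero_mem' := by
    change InDomL ν τ 0
    simp [InDomL, fourierCoef_zero]
  add_mem' := by
    intro u v hu hv
    change InDomL ν τ (u + v)
    rw [inDomL_iff, multSeq_add]
    exact ((inDomL_iff ν τ u).1 hu).add ((inDomL_iff ν τ v).1 hv)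
  smul_mem' := by
    intro c u hu
    change InDomL ν τ (c • u)
    rw [inDomL_iff, multSeq_smul]
    exact ((inDomL_iff ν τ u).1 hu).const_smul c

/-- The unbounded operator `𝔏` in `L2`: on its natural domain, `𝔏 u` is the element of `L2`
with Fourier coefficients `L(k) û(k)`. -/
def opL (ν τ : ℝ) : L2 →ₗ.[ℂ] L2 where
  domain := domL ν τ
  toFun :=
    { toFun := fun u => expBasis.repr.symm ⟨multSeq ν τ u, (inDomL_iff ν τ u).1 u.2⟩
      map_add' := by
        intro u v
        rw [← map_add]
        congr 1
        ext k
        exact congrFun (multSeq_add ν τ u v) k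
      map_smul' := by
        intro c u
        rw [RingHom.id_apply, ← map_smul]
        congr 1
        ext k
        exact congrFun (multSeq_smul ν τ c u) k }

theorem fourierCoef_opL (ν τ : ℝ) (u : (opL ν τ).domain) (k : Fin 2 → ℤ) :
    fourierCoef (opL ν τ u) k = (symbolL ν τ k : ℂ) * fourierCoef (u : L2) k := by
  rw [← expBasis_repr]
  change expBasis.repr (expBasis.repr.symm _) k = _
  rw [LinearIsometryEquiv.apply_symm_apply]
  rfl

/-- The kernel of `𝔏`, a subspace of `L2`. -/
def kerL (ν τ : ℝ) : Submodule ℂ L2 :=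
  (LinearMap.ker (opL ν τ).toFun).map (opL ν τ).domain.subtype

/-- The vector `k₀ = (1, 1)`. -/
def k0 : Fin 2 → ℤ := ![1, 1]

/-- The vector `k₀* = (-1, 1)`. -/
def k0star : Fin 2 → ℤ := ![-1, 1]

/-- `v` lies in the domain of `𝔏` and `(𝔏 - ϰ) v = u`. -/
def Solves (ν τ κ : ℝ) (v u : L2) : Prop :=
  ∃ h : v ∈ (opL ν τ).domain, opL ν τ ⟨v, h⟩ - (κ : ℂ) • v = u

/-! ### The perturbed parameters -/

/-- The critical value `μ_c(τ) = (1 + τ²)^{-1/2}`. -/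
def muC (τ : ℝ) : ℝ := (√(1 + τ ^ 2))⁻¹

/-- The coefficient `ν₁(τ)`. -/
def nuOne (τ : ℝ) : ℝ :=
  1 / (4 * muC τ ^ 5) - 1 / (2 * muC τ ^ 4) + 1 / (2 * muC τ ^ 3) + 7 / (8 * muC τ ^ 2)
    - 1 / (4 * muC τ) - 9 / (16 * (2 - muC τ))

/-- The conditions on the functions `ν̃_j`, `ϰ̃_j`, `j ≥ 1`, on the segment `[0, r₀]`. -/
structure PerturbationBounds (r₀ R : ℝ) (nuT kaT : ℕ → ℝ → ℝ) : Prop where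
  bounded : ∀ j, 1 ≤ j → ∀ ε ∈ Set.Icc 0 r₀, |nuT j ε| + |kaT j ε| ≤ R
  lipschitz : ∀ j, 1 ≤ j → ∀ ε ∈ Set.Icc 0 r₀, ∀ ε' ∈ Set.Icc 0 r₀,
    |nuT j ε - nuT j ε'| + |kaT j ε - kaT j ε'| ≤ R * |ε - ε'|
  cauchy : ∀ j, 1 ≤ j → ∀ ε ∈ Set.Icc 0 r₀,
    |nuT (j + 1) ε - nuT j ε| + |kaT (j + 1) ε - kaT j ε| ≤ R / 2 ^ j

/-- `ν_j(ε) = ν₀ - ε² ν₁(τ) + ε³ ν̃_j(ε)`. -/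
def nuPert (ν₀ τ : ℝ) (nuT : ℕ → ℝ → ℝ) (j : ℕ) (ε : ℝ) : ℝ :=
  ν₀ - ε ^ 2 * nuOne τ + ε ^ 3 * nuT j ε

/-- `ϰ_j(ε) = ε² ϰ̃_j(ε)`. -/
def kaPert (kaT : ℕ → ℝ → ℝ) (j : ℕ) (ε : ℝ) : ℝ := ε ^ 2 * kaT j ε

end SmallDivisor

end

open MeasureTheory Filter Topology
open scoped ENNReal

namespace SmallDivisor

/-! Everything is diagonal in Fourier space: inverting `𝔏 - ϰ` divides coefficients by `L(k) - ϰ`,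
so both parts reduce to lower bounds `c (1 + |k|)^(-β)` for `|L(k) - ϰ|` off the five kernel
frequencies, with `β = (1 + α)/2` in (a) and `β = 1` in (b).

For (a), rationalising `L(k)` shows that away from the parabolas `|k₂| = k₁²` it is small only if
`ν₀` is close to one resonant value `resNu k` (`parDist_mul_le`). Since `|x - ρ|^(-p)` is locally
integrable uniformly in `ρ` when `p < 1`, a weighted sum of such singularities at all `resNu k`
converges for a.e. `ν₀` (`ae_isDiophantine`). Boundedness of its terms gives `|L(k)| ≥ c (1 +
|k₁|)^(-(1+α))` (`exists_le_symbolL`). Where `k₁²` is not `O(1 + |k|)` the symbol is large, so the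
loss in `|k|` has half that exponent (`sq_le_or_symbolL_le`).

For (b), the parameters shift the symbol by `k₁² ε² ν₁` plus smaller terms, and `ν₁ ≠ 0` for a.e.
`ν₀`. At large `|k₁|` the shift expands distances in `ε²`, so the `ε ≤ r` with perturbed symbol
below `2c/k₁²` form a set of length `O(r k₁⁻² |L(k)|⁻¹)`, empty unless `|L(k)| = O(r² k₁²)`
(`volume_badSet_inter_le`). The geometric Cauchy condition leaves only about `√|k₁|` indices `j` to
exclude for each `k`. The total length is `r` times a part of the convergent series `∑ |k₁|^(-3/2)
|L(k)|⁻¹` (`summable_nearRes`), and this part tends to `0` with `r`. Hence the excluded set has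
density zero at the origin. -/

/-! ### Almost everywhere convergent sums of power singularities. -/

theorem lintegral_abs_rpow_lt_top {p : ℝ} (hp : p < 1) :
    ∫⁻ x in Set.Icc (-1 : ℝ) 1, ENNReal.ofReal (|x| ^ (-p)) < ⊤ := by
  have h : IntervalIntegrable (fun x : ℝ => |x| ^ (-p)) volume (-1) 1 := by
    refine intervalIntegrable_of_even (fun x => by simp) fun x hx => ?_
    refine (intervalIntegral.intervalIntegrable_rpow' (r := -p) (by linarith)).congr ?_
    intro y hy
    rw [Set.uIoc_of_le hx.le] at hy
    simp only [abs_of_pos hy.1]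
  rw [intervalIntegrable_iff_integrableOn_Icc_of_le (by norm_num)] at h
  exact h.lintegral_lt_top

/-- Within distance `1` of `ρ` translate the singularity to the origin; farther away the integrand
is at most `1`. The point is that the bound does not depend on `ρ`. -/
theorem lintegral_abs_sub_rpow_le {p : ℝ} (hp0 : 0 < p) (ρ : ℝ) (n : ℕ) :
    ∫⁻ x in Set.Icc (-(n : ℝ)) n, ENNReal.ofReal (|x - ρ| ^ (-p)) ≤
      (∫⁻ x in Set.Icc (-1 : ℝ) 1, ENNReal.ofReal (|x| ^ (-p))) + ENNReal.ofReal (2 * n) := by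
  set f : ℝ → ℝ≥0∞ := (Set.Icc (-1 : ℝ) 1).indicator fun x => ENNReal.ofReal (|x| ^ (-p)) with hf
  have hmeas : Measurable f := by
    refine Measurable.indicator ?_ measurableSet_Icc
    fun_prop
  have hle : ∀ x : ℝ, ENNReal.ofReal (|x - ρ| ^ (-p)) ≤ f (x - ρ) + 1 := by
    intro x
    by_cases hx : x - ρ ∈ Set.Icc (-1 : ℝ) 1
    · simp [hf, Set.indicator_of_mem hx]
    · have h1 : 1 ≤ |x - ρ| := by
        by_contra! h
        exact hx (abs_le.1 h.le)
      refine le_add_left ?_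
      rw [ENNReal.ofReal_le_one]
      exact Real.rpow_le_one_of_one_le_of_nonpos h1 (by linarith)
  calc ∫⁻ x in Set.Icc (-(n : ℝ)) n, ENNReal.ofReal (|x - ρ| ^ (-p))
      ≤ ∫⁻ x in Set.Icc (-(n : ℝ)) n, (f (x - ρ) + 1) := lintegral_mono hle
    _ = (∫⁻ x in Set.Icc (-(n : ℝ)) n, f (x - ρ)) + ∫⁻ x in Set.Icc (-(n : ℝ)) n, 1 :=
        lintegral_add_right _ measurable_const
    _ ≤ (∫⁻ x, f (x - ρ)) + ENNReal.ofReal (2 * n) := by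
        gcongr
        · exact Measure.restrict_le_self
        · rw [setLIntegral_one, Real.volume_Icc]
          apply le_of_eq
          congr 1
          ring
    _ = _ := by
        rw [lintegral_sub_right_eq_self f ρ, hf, lintegral_indicator measurableSet_Icc]

/-- For summable weights, `∑ wᵢ |x - ρᵢ|⁻ᵖ` converges for almost every `x` when `p < 1`. -/
theorem ae_summable_mul_abs_sub_rpow {ι : Type*} [Countable ι] (w ρ : ι → ℝ)
    (hw : ∀ i, 0 ≤ w i) (hs : Summable w) {p : ℝ} (hp0 : 0 < p) (hp : p < 1) :
    ∀ᵐ x : ℝ, Summable fun i => w i * |x - ρ i| ^ (-p) := by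
  have hm : ∀ i, Measurable fun x : ℝ => ENNReal.ofReal (w i * |x - ρ i| ^ (-p)) := by
    intro i
    fun_prop
  have key : ∀ n : ℕ, ∀ᵐ x ∂volume.restrict (Set.Icc (-(n : ℝ)) n),
      Summable fun i => w i * |x - ρ i| ^ (-p) := by
    intro n
    set B := (∫⁻ x in Set.Icc (-1 : ℝ) 1, ENNReal.ofReal (|x| ^ (-p))) + ENNReal.ofReal (2 * n)
    have hB : B ≠ ⊤ :=
      ENNReal.add_ne_top.2 ⟨(lintegral_abs_rpow_lt_top hp).ne, ENNReal.ofReal_ne_top⟩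
    -- Tonelli: the integral of the sum is at most `(∑ wᵢ) B`, with `B` independent of `i`.
    have hfin : ∫⁻ x in Set.Icc (-(n : ℝ)) n,
        ∑' i, ENNReal.ofReal (w i * |x - ρ i| ^ (-p)) ≠ ⊤ := by
      rw [lintegral_tsum fun i => (hm i).aemeasurable]
      refine ne_top_of_le_ne_top (ENNReal.mul_ne_top hs.tsum_ofReal_ne_top hB) ?_
      rw [← ENNReal.tsum_mul_right]
      refine ENNReal.tsum_le_tsum fun i => ?_
      simp only [ENNReal.ofReal_mul (hw i)]
      rw [lintegral_const_mul _ (by fun_prop)]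
      gcongr
      exact lintegral_abs_sub_rpow_le hp0 _ _
    filter_upwards [ae_lt_top (Measurable.tsum hm) hfin] with x hx
    refine (ENNReal.summable_toReal hx.ne).congr fun i => ?_
    exact ENNReal.toReal_ofReal (mul_nonneg (hw i) (by positivity))
  have hU : (⋃ n : ℕ, Set.Icc (-(n : ℝ)) n) = Set.univ := by
    refine Set.eq_univ_of_forall fun x => Set.mem_iUnion.2 ?_
    obtain ⟨n, hn⟩ := exists_nat_ge |x|
    exact ⟨n, abs_le.1 hn⟩
  have := (ae_restrict_iUnion_iff (fun n : ℕ => Set.Icc (-(n : ℝ)) n) _).2 key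
  rwa [hU, Measure.restrict_univ] at this

/-! ### Resonances and lower bounds for the unperturbed symbol. -/

/-- The distance of `k` from the parabolas `k₂ = ± k₁²`, measured along the second axis. -/
noncomputable def parDist (k : Fin 2 → ℤ) : ℝ := |((k 0 : ℝ) ^ 2 - |(k 1 : ℝ)|)|

/-- The weights `|k₁|⁻ᵗ |k₁² - |k₂||⁻ᵗ`; they vanish where a factor degenerates. -/
noncomputable def weight (t : ℝ) (k : Fin 2 → ℤ) : ℝ := |(k 0 : ℝ)| ^ (-t) * parDist k ^ (-t)

theorem weight_nonneg (t : ℝ) (k : Fin 2 → ℤ) : 0 ≤ weight t k := by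
  unfold weight parDist
  positivity

/-- For each sign of `k₂` the map `k ↦ (k₁, k₁² - |k₂|)` is injective into `ℤ²`, so the sum is
dominated by two products of convergent `p`-series. -/
theorem summable_weight {t : ℝ} (ht : 1 < t) : Summable (weight t) := by
  have h1 : Summable fun n : ℤ => |(n : ℝ)| ^ (-t) := Real.summable_abs_int_rpow ht
  have h2 : Summable fun q : ℤ × ℤ => |(q.1 : ℝ)| ^ (-t) * |(q.2 : ℝ)| ^ (-t) :=
    h1.mul_of_nonneg h1 (fun _ => by positivity) (fun _ => by positivity)
  let e (σ : ℤ) (k : Fin 2 → ℤ) : ℤ × ℤ := (k 0, k 0 ^ 2 + σ * k 1)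
  have he : ∀ σ : ℤ, σ ≠ 0 → Function.Injective (e σ) := by
    intro σ hσ k l hkl
    simp only [e, Prod.mk.injEq] at hkl
    obtain ⟨h0, h1⟩ := hkl
    rw [h0] at h1
    funext i
    fin_cases i
    · exact h0
    · exact mul_left_cancel₀ hσ (add_left_cancel h1)
  have h3 := h2.comp_injective (he 1 one_ne_zero)
  have h4 := h2.comp_injective (he (-1) (by norm_num))
  refine (h3.add h4).of_nonneg_of_le (weight_nonneg t) fun k => ?_
  simp only [weight, parDist, e, Function.comp_apply]
  push_cast
  rcases abs_cases (k 1 : ℝ) with ⟨h, _⟩ | ⟨h, _⟩ <;> rw [h]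
  · refine le_add_of_nonneg_of_le (by positivity) (le_of_eq ?_)
    ring_nf
  · refine le_add_of_le_of_nonneg (le_of_eq ?_) (by positivity)
    ring_nf

/-- The frequencies of the kernel of `𝔏₀`. -/
def kerFreq : Set (Fin 2 → ℤ) := {0, k0, -k0, k0star, -k0star}

theorem mem_kerFreq_of_abs_le_one {k : Fin 2 → ℤ} (h0 : |k 0| ≤ 1) (h1 : |k 1| = |k 0|) :
    k ∈ kerFreq := by
  obtain ⟨h2, h3⟩ := abs_le.1 h0
  have h4 : k 1 = k 0 ∨ k 1 = -k 0 := abs_eq_abs.1 h1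
  have hk : k = ![k 0, k 1] := by
    funext i
    fin_cases i <;> rfl
  rw [hk]
  simp only [kerFreq, k0, k0star, Set.mem_insert_iff, Set.mem_singleton_iff]
  obtain h5 | h5 | h5 : k 0 = -1 ∨ k 0 = 0 ∨ k 0 = 1 := by omega
  all_goals rcases h4 with h4 | h4 <;> rw [h4, h5] <;> simp [funext_iff, Fin.forall_fin_two]

/-- The axis `k₁ = 0` and the parabolas carry no small divisors off the kernel; only the third case
needs arithmetic of `ν₀`. -/
theorem not_mem_kerFreq_cases {k : Fin 2 → ℤ} (hk : k ∉ kerFreq) :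
    (k 0 = 0 ∧ k 1 ≠ 0) ∨ (2 ≤ |k 0| ∧ |k 1| = k 0 ^ 2) ∨ (k 0 ≠ 0 ∧ |k 1| ≠ k 0 ^ 2) := by
  by_cases h0 : k 0 = 0
  · refine Or.inl ⟨h0, fun h1 => hk (mem_kerFreq_of_abs_le_one ?_ ?_)⟩ <;> simp [h0, h1]
  · by_cases h1 : |k 1| = k 0 ^ 2
    · refine Or.inr (Or.inl ⟨?_, h1⟩)
      by_contra! h2
      have h3 : |k 0| = 1 := by
        have := abs_pos.2 h0
        omega
      refine hk (mem_kerFreq_of_abs_le_one h3.le ?_)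
      rw [h1, ← sq_abs, h3]
      norm_num
    · exact Or.inr (Or.inr ⟨h0, h1⟩)

theorem symbolL_eq_zero_of_mem {ν τ : ℝ} (hν : ν = √(1 + τ ^ 2)) {k : Fin 2 → ℤ}
    (hk : k ∈ kerFreq) : symbolL ν τ k = 0 := by
  simp only [kerFreq, k0, k0star, Set.mem_insert_iff, Set.mem_singleton_iff] at hk
  rcases hk with rfl | rfl | rfl | rfl | rfl <;> simp [symbolL, hν]

/-- The value of `ν₀` at which the symbol of `𝔏₀` vanishes at `k`. -/
noncomputable def resNu (k : Fin 2 → ℤ) : ℝ :=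
  √(((k 0 : ℝ) ^ 2 - (k 1 : ℝ) ^ 2) / ((k 0 : ℝ) ^ 4 - (k 1 : ℝ) ^ 2))

/-- Passes from `ν²` to `ν` in the resonance relation. Negative `l` must be allowed, because the
quotient in `resNu` may be negative and its root is then `0`. -/
theorem abs_sub_sqrt_le {ν : ℝ} (hν : 1 ≤ ν) (l : ℝ) : |ν - √l| ≤ |ν ^ 2 - l| := by
  rcases le_or_gt 0 l with hl | hl
  · have h1 : ν ^ 2 - l = (ν - √l) * (ν + √l) := by
      linear_combination Real.sq_sqrt hl
    rw [h1, abs_mul]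
    refine le_mul_of_one_le_right (abs_nonneg _) ?_
    rw [abs_of_nonneg (by positivity)]
    linarith [Real.sqrt_nonneg l]
  · rw [Real.sqrt_eq_zero_of_nonpos hl.le, sub_zero, abs_of_pos (by linarith), abs_of_pos]
    all_goals nlinarith

theorem one_le_abs_cast {n : ℤ} (h : n ≠ 0) : (1 : ℝ) ≤ |(n : ℝ)| := by
  exact_mod_cast Int.one_le_abs h

theorem abs_cast_le_sq (n : ℤ) : |(n : ℝ)| ≤ (n : ℝ) ^ 2 := by
  have : |n| ≤ n ^ 2 := by
    rw [← sq_abs]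
    rcases eq_or_ne n 0 with rfl | h
    · simp
    · nlinarith [Int.one_le_abs h]
  exact_mod_cast this

theorem one_le_parDist {k : Fin 2 → ℤ} (h : |k 1| ≠ k 0 ^ 2) : 1 ≤ parDist k := by
  have : 1 ≤ |(k 0 ^ 2 - |k 1|)| := Int.one_le_abs (sub_ne_zero.2 h.symm)
  unfold parDist
  exact_mod_cast this

section Ground

variable {ν τ : ℝ} (hτ : 0 < τ) (hν : ν = √(1 + τ ^ 2))
include hτ hν

theorem nu_sq : ν ^ 2 = 1 + τ ^ 2 := by
  rw [hν, Real.sq_sqrt (by positivity)]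

theorem one_lt_nu : 1 < ν := by
  rw [hν]
  exact Real.lt_sqrt_of_sq_lt (by nlinarith)

omit hτ in
theorem tau_lt_nu : τ < ν := by
  rw [hν]
  exact Real.lt_sqrt_of_sq_lt (by linarith)

omit hν in
theorem sqrt_symbol_le (k : Fin 2 → ℤ) :
    √((k 0 : ℝ) ^ 2 + τ ^ 2 * (k 1 : ℝ) ^ 2) ≤ (k 0 : ℝ) ^ 2 + τ * |(k 1 : ℝ)| := by
  rw [Real.sqrt_le_left (by positivity), ← sq_abs (k 0 : ℝ), ← sq_abs (k 1 : ℝ)]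
  have h1 := abs_cast_le_sq (k 0)
  rw [← sq_abs] at h1
  have h2 : 0 ≤ |(k 0 : ℝ)| := abs_nonneg _
  have h3 : 0 ≤ τ * |(k 1 : ℝ)| := by positivity
  nlinarith [mul_nonneg (sq_nonneg |(k 0 : ℝ)|) h3]

omit hτ hν in
theorem tau_mul_le_sqrt_symbol (k : Fin 2 → ℤ) :
    τ * |(k 1 : ℝ)| ≤ √((k 0 : ℝ) ^ 2 + τ ^ 2 * (k 1 : ℝ) ^ 2) := by
  apply Real.le_sqrt_of_sq_le
  rw [mul_pow, sq_abs]
  nlinarith [sq_nonneg (k 0 : ℝ)]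

/-- With `τ² = ν² - 1`, the left side is `L(k)` times its conjugate `ν k₁² + √(k₁² + τ² k₂²)`, up to
sign. -/
theorem abs_numerator_le (k : Fin 2 → ℤ) :
    |ν ^ 2 * ((k 0 : ℝ) ^ 4 - (k 1 : ℝ) ^ 2) - ((k 0 : ℝ) ^ 2 - (k 1 : ℝ) ^ 2)| ≤
      |symbolL ν τ k| * ((ν + 1) * ((k 0 : ℝ) ^ 2 + |(k 1 : ℝ)|)) := by
  have h1 := one_lt_nu hτ hν
  have h2 := tau_lt_nu hν
  have h3 := sqrt_symbol_le hτ k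
  have hs : √((k 0 : ℝ) ^ 2 + τ ^ 2 * (k 1 : ℝ) ^ 2) ^ 2 = (k 0 : ℝ) ^ 2 + τ ^ 2 * (k 1 : ℝ) ^ 2 :=
    Real.sq_sqrt (by positivity)
  have h4 : ν ^ 2 * ((k 0 : ℝ) ^ 4 - (k 1 : ℝ) ^ 2) - ((k 0 : ℝ) ^ 2 - (k 1 : ℝ) ^ 2) =
      -symbolL ν τ k *
        (ν * (k 0 : ℝ) ^ 2 + √((k 0 : ℝ) ^ 2 + τ ^ 2 * (k 1 : ℝ) ^ 2)) := by
    unfold symbolL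
    linear_combination hs - (k 1 : ℝ) ^ 2 * nu_sq hτ hν
  rw [h4, abs_mul, abs_neg]
  gcongr
  rw [abs_of_nonneg (by positivity)]
  nlinarith [abs_nonneg (k 1 : ℝ), sq_nonneg (k 0 : ℝ)]

/-- Factor `k₁⁴ - k₂² = (k₁² - |k₂|)(k₁² + |k₂|)`: the second factor cancels the bound on the
conjugate, leaving the parabola distance. -/
theorem parDist_mul_le {k : Fin 2 → ℤ} (h0 : k 0 ≠ 0) (h1 : |k 1| ≠ k 0 ^ 2) :
    parDist k * |ν - resNu k| ≤ (ν + 1) * |symbolL ν τ k| := by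
  have hν1 := one_lt_nu hτ hν
  have hA : (k 0 : ℝ) ^ 4 - (k 1 : ℝ) ^ 2 =
      ((k 0 : ℝ) ^ 2 - |(k 1 : ℝ)|) * ((k 0 : ℝ) ^ 2 + |(k 1 : ℝ)|) := by
    rw [← sq_abs (k 1 : ℝ)]
    ring
  have hP : 0 < (k 0 : ℝ) ^ 2 + |(k 1 : ℝ)| := by
    have : (k 0 : ℝ) ≠ 0 := by exact_mod_cast h0
    positivity
  have hA0 : (k 0 : ℝ) ^ 4 - (k 1 : ℝ) ^ 2 ≠ 0 := by
    rw [hA]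
    refine mul_ne_zero (fun h => ?_) hP.ne'
    have := one_le_parDist h1
    rw [parDist, h, abs_zero] at this
    linarith
  have h2 := abs_numerator_le hτ hν k
  have h3 := abs_sub_sqrt_le hν1.le
    (((k 0 : ℝ) ^ 2 - (k 1 : ℝ) ^ 2) / ((k 0 : ℝ) ^ 4 - (k 1 : ℝ) ^ 2))
  have h4 : ν ^ 2 * ((k 0 : ℝ) ^ 4 - (k 1 : ℝ) ^ 2) - ((k 0 : ℝ) ^ 2 - (k 1 : ℝ) ^ 2) =
      ((k 0 : ℝ) ^ 4 - (k 1 : ℝ) ^ 2) *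
      (ν ^ 2 - ((k 0 : ℝ) ^ 2 - (k 1 : ℝ) ^ 2) / ((k 0 : ℝ) ^ 4 - (k 1 : ℝ) ^ 2)) := by
    field_simp
  rw [h4, abs_mul, hA, abs_mul, abs_of_pos hP, ← hA] at h2
  change |ν - resNu k| ≤ _ at h3
  change parDist k * _ * _ ≤ _ at h2
  have h5 : 0 ≤ parDist k := abs_nonneg _
  refine le_of_mul_le_mul_right ?_ hP
  calc parDist k * |ν - resNu k| * ((k 0 : ℝ) ^ 2 + |(k 1 : ℝ)|)
      = parDist k * ((k 0 : ℝ) ^ 2 + |(k 1 : ℝ)|) * |ν - resNu k| := by ring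
    _ ≤ _ := mul_le_mul_of_nonneg_left h3 (by positivity)
    _ ≤ _ := h2
    _ = _ := by ring

/-- The coefficient of `ν²` in the rationalised symbol vanishes here, so no choice of `ν` can make
it resonant once `|k₁| ≥ 2`. -/
theorem le_symbolL_on_parabola {k : Fin 2 → ℤ} (h0 : k 0 ≠ 0) (h1 : |k 1| = k 0 ^ 2) :
    (k 0 : ℝ) ^ 2 - 1 ≤ 2 * (ν + 1) * |symbolL ν τ k| := by
  have h2 := abs_numerator_le hτ hν k
  have h3 : |(k 1 : ℝ)| = (k 0 : ℝ) ^ 2 := by exact_mod_cast h1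
  have h4 : (k 1 : ℝ) ^ 2 = (k 0 : ℝ) ^ 4 := by
    rw [← sq_abs, h3]
    ring
  have h5 : (0 : ℝ) < (k 0 : ℝ) ^ 2 := by
    have : (k 0 : ℝ) ≠ 0 := by exact_mod_cast h0
    positivity
  rw [h4, h3] at h2
  refine le_of_mul_le_mul_right ?_ h5
  calc ((k 0 : ℝ) ^ 2 - 1) * (k 0 : ℝ) ^ 2
      = ν ^ 2 * ((k 0 : ℝ) ^ 4 - (k 0 : ℝ) ^ 4) - ((k 0 : ℝ) ^ 2 - (k 0 : ℝ) ^ 4) := by ring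
    _ ≤ _ := (le_abs_self _).trans h2
    _ = _ := by ring

omit hν in
theorem parDist_le_or_lt_symbolL (k : Fin 2 → ℤ) :
    parDist k ≤ (1 + (ν + 1) / τ) * (k 0 : ℝ) ^ 2 ∨ (k 0 : ℝ) ^ 2 < |symbolL ν τ k| := by
  rw [or_iff_not_imp_right, not_lt]
  intro h
  have h1 := (le_abs_self _).trans h
  have h2 := tau_mul_le_sqrt_symbol (τ := τ) k
  unfold symbolL at h1
  have h3 : |(k 1 : ℝ)| ≤ (ν + 1) / τ * (k 0 : ℝ) ^ 2 := by
    rw [div_mul_eq_mul_div, le_div_iff₀ hτ]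
    linarith
  unfold parDist
  rw [abs_le]
  constructor <;> nlinarith [abs_nonneg (k 1 : ℝ), sq_nonneg (k 0 : ℝ)]

/-- Converts bounds in `k₁` into bounds in `|k|`: either `|k₂|` is at least of order `k₁²`, or the
root is at most half of `ν k₁²` and the symbol is far from zero. -/
theorem sq_le_or_symbolL_le (k : Fin 2 → ℤ) :
    (1 + |(k 0 : ℝ)|) ^ 2 ≤ 8 * (1 + freqLength k) ∨
      (2 ≤ |(k 0 : ℝ)| ∧ symbolL ν τ k ≤ -(ν * (k 0 : ℝ) ^ 2 / 2)) := by
  have hν1 := one_lt_nu hτ hν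
  have hf : |(k 1 : ℝ)| ≤ freqLength k := by
    apply Real.le_sqrt_of_sq_le
    rw [sq_abs]
    nlinarith [sq_nonneg (k 0 : ℝ)]
  have hf0 : 0 ≤ freqLength k := Real.sqrt_nonneg _
  rcases le_or_gt |(k 0 : ℝ)| 1 with h | h
  · left
    nlinarith [abs_nonneg (k 0 : ℝ)]
  have h2 : 2 ≤ |(k 0 : ℝ)| := by
    have : 1 < |k 0| := by exact_mod_cast h
    exact_mod_cast this
  rcases le_or_gt ((k 0 : ℝ) ^ 2 / 2) |(k 1 : ℝ)| with h1 | h1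
  · left
    rw [← sq_abs] at h1
    nlinarith
  · right
    refine ⟨h2, ?_⟩
    have h3 : √((k 0 : ℝ) ^ 2 + τ ^ 2 * (k 1 : ℝ) ^ 2) ≤ ν * (k 0 : ℝ) ^ 2 / 2 := by
      rw [Real.sqrt_le_left (by positivity)]
      rw [← sq_abs (k 0 : ℝ)] at h1 ⊢
      rw [← sq_abs (k 1 : ℝ)]
      have h4 : |(k 1 : ℝ)| ^ 2 ≤ (|(k 0 : ℝ)| ^ 2 / 2) ^ 2 := by gcongr
      have h5 : τ ^ 2 * |(k 1 : ℝ)| ^ 2 ≤ τ ^ 2 * (|(k 0 : ℝ)| ^ 2 / 2) ^ 2 := by gcongr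
      have h7 : 4 ≤ |(k 0 : ℝ)| ^ 2 := by nlinarith
      have h6 : |(k 0 : ℝ)| ^ 2 ≤ (|(k 0 : ℝ)| ^ 2 / 2) ^ 2 := by nlinarith
      calc _ ≤ (|(k 0 : ℝ)| ^ 2 / 2) ^ 2 + τ ^ 2 * (|(k 0 : ℝ)| ^ 2 / 2) ^ 2 := by gcongr
        _ = (ν * |(k 0 : ℝ)| ^ 2 / 2) ^ 2 := by
          linear_combination -(|(k 0 : ℝ)| ^ 4 / 4) * nu_sq hτ hν
    unfold symbolL
    linarith

end Ground

/-! ### Diophantine parameters and the small divisor series. -/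

/-- The Diophantine condition on `ν₀` behind the small divisor estimates. -/
structure IsDiophantine (δ ν : ℝ) : Prop where
  ne_resNu : ∀ k, ν ≠ resNu k
  summable : Summable fun k => weight (1 + δ) k * |ν - resNu k| ^ (-(1 - δ))

theorem ae_isDiophantine {δ : ℝ} (h0 : 0 < δ) (h1 : δ < 1) : ∀ᵐ ν : ℝ, IsDiophantine δ ν := by
  have hne : ∀ᵐ ν : ℝ, ∀ k, ν ≠ resNu k := ae_all_iff.2 fun k => Measure.ae_ne volume _
  filter_upwards [hne, ae_summable_mul_abs_sub_rpow (weight (1 + δ)) resNu (weight_nonneg _)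
    (summable_weight (by linarith)) (sub_pos.2 h1) (by linarith : 1 - δ < 1)] with ν h2 h3
  exact ⟨h2, h3⟩

/-- A Diophantine `ν` keeps a distance from the resonant values. -/
theorem IsDiophantine.exists_le_abs_sub {δ ν : ℝ} (h0 : 0 < δ) (h1 : δ < 1)
    (h : IsDiophantine δ ν) : ∃ c : ℝ, 0 < c ∧ ∀ k : Fin 2 → ℤ, k 0 ≠ 0 → |k 1| ≠ k 0 ^ 2 →
      c * (|(k 0 : ℝ)| * parDist k) ^ (-((1 + δ) / (1 - δ))) ≤ |ν - resNu k| := by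
  have hp : 0 < 1 - δ := sub_pos.2 h1
  have hnn : ∀ k, 0 ≤ weight (1 + δ) k * |ν - resNu k| ^ (-(1 - δ)) := fun k =>
    mul_nonneg (weight_nonneg _ k) (by positivity)
  set C := (∑' k, weight (1 + δ) k * |ν - resNu k| ^ (-(1 - δ))) + 1 with hC
  have hC0 : 0 < C := by
    have : 0 ≤ ∑' k, weight (1 + δ) k * |ν - resNu k| ^ (-(1 - δ)) := tsum_nonneg hnn
    linarith
  refine ⟨(C⁻¹) ^ ((1 - δ)⁻¹), by positivity, fun k hk0 hk1 => ?_⟩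
  have hx : 0 < |ν - resNu k| := abs_pos.2 (sub_ne_zero.2 (h.ne_resNu k))
  have hM : 0 < parDist k := zero_lt_one.trans_le (one_le_parDist hk1)
  have hN : 0 < |(k 0 : ℝ)| := zero_lt_one.trans_le (one_le_abs_cast hk0)
  -- A single nonnegative term is bounded by the whole sum; solving for `|ν - resNu k|` gives the
  -- claim.
  have h2 : weight (1 + δ) k * |ν - resNu k| ^ (-(1 - δ)) ≤ C := by
    have := h.summable.le_tsum k fun j _ => hnn j
    linarith
  rw [weight, ← Real.mul_rpow hN.le hM.le, Real.rpow_neg hx.le, ← div_eq_mul_inv,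
    div_le_iff₀ (by positivity)] at h2
  have h3 : C⁻¹ * (|(k 0 : ℝ)| * parDist k) ^ (-(1 + δ)) ≤ |ν - resNu k| ^ (1 - δ) := by
    rwa [inv_mul_le_iff₀ hC0]
  have h4 := Real.rpow_le_rpow (by positivity) h3 (inv_nonneg.2 hp.le)
  rw [← Real.rpow_mul hx.le, mul_inv_cancel₀ hp.ne', Real.rpow_one,
    Real.mul_rpow (by positivity) (by positivity), ← Real.rpow_mul (by positivity)] at h4
  have h5 : -((1 + δ) / (1 - δ)) = -(1 + δ) * (1 - δ)⁻¹ := by rw [div_eq_mul_inv, neg_mul]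
  rwa [h5]

theorem exponent_ratio_le {α : ℝ} (hα : 0 < α) (hα1 : α ≤ 1) :
    3 * ((1 + α / 14) / (1 - α / 14)) ≤ 3 + α := by
  rw [← mul_div_assoc, div_le_iff₀ (by linarith)]
  nlinarith

/-- The small divisors of `𝔏₀` decay at most like `|k₁|⁻⁽¹⁺ᵅ⁾`. -/
theorem exists_le_symbolL {α ν τ : ℝ} (hα : 0 < α) (hα1 : α ≤ 1) (hτ : 0 < τ)
    (hν : ν = √(1 + τ ^ 2)) (h : IsDiophantine (α / 14) ν) :
    ∃ c : ℝ, 0 < c ∧ ∀ k, k ∉ kerFreq →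
      c * (1 + |(k 0 : ℝ)|) ^ (-(1 + α)) ≤ |symbolL ν τ k| := by
  have hν1 := one_lt_nu hτ hν
  obtain ⟨c, hc, hcb⟩ := h.exists_le_abs_sub (by linarith) (by linarith)
  set s := (1 + α / 14) / (1 - α / 14) with hs
  have hs3 : 3 * s ≤ 3 + α := exponent_ratio_le hα hα1
  have hs1 : 1 ≤ s := by
    rw [hs, one_le_div (by linarith only [hα1])]
    linarith only [hα]
  set C := 1 + (ν + 1) / τ with hC
  have hC1 : 1 ≤ C := le_add_of_nonneg_right (by positivity)
  have hle1 : ∀ k : Fin 2 → ℤ, (1 + |(k 0 : ℝ)|) ^ (-(1 + α)) ≤ 1 := fun k =>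
    Real.rpow_le_one_of_one_le_of_nonpos (by linarith only [abs_nonneg (k 0 : ℝ)])
      (by linarith only [hα])
  set m := min (min 1 τ) (min ((2 * (ν + 1))⁻¹) (c * C ^ (1 - s) / (ν + 1)))
  have hm : 0 < m := by positivity
  have hred : ∀ (k : Fin 2 → ℤ) (b : ℝ), m ≤ b → b ≤ |symbolL ν τ k| →
      m * (1 + |(k 0 : ℝ)|) ^ (-(1 + α)) ≤ |symbolL ν τ k| := fun k b h1 h2 =>
    (mul_le_of_le_one_right hm.le (hle1 k)).trans (h1.trans h2)
  refine ⟨m, hm, fun k hk => ?_⟩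
  obtain ⟨h0, h1⟩ | ⟨h0, h1⟩ | ⟨h0, h1⟩ := not_mem_kerFreq_cases hk
  · refine hred k τ ((min_le_left _ _).trans (min_le_right _ _)) ?_
    refine le_trans ?_ (le_abs_self _)
    unfold symbolL
    have := tau_mul_le_sqrt_symbol (τ := τ) k
    have h2 := one_le_abs_cast h1
    simp only [h0, Int.cast_zero] at this ⊢
    nlinarith only [this, h2, hτ]
  · refine hred k (2 * (ν + 1))⁻¹ ((min_le_right _ _).trans (min_le_left _ _)) ?_
    have hne : k 0 ≠ 0 := by
      rintro h2
      simp [h2] at h0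
    have h2 := le_symbolL_on_parabola hτ hν hne h1
    have h3 : (2 : ℝ) ≤ |(k 0 : ℝ)| := by exact_mod_cast h0
    rw [inv_le_iff_one_le_mul₀ (by positivity), mul_comm]
    rw [← sq_abs] at h2
    nlinarith only [h2, h3]
  · have hN := one_le_abs_cast h0
    rcases parDist_le_or_lt_symbolL hτ k with h2 | h2
    · have hM := one_le_parDist h1
      have hM0 : 0 < parDist k := by linarith only [hM]
      have hN0 : 0 < |(k 0 : ℝ)| := by linarith only [hN]
      have h3 := parDist_mul_le hτ hν h0 h1
      have h4 := hcb k h0 h1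
      rw [Real.mul_rpow hN0.le hM0.le] at h4
      -- Since `1 - s ≤ 0`, the upper bound `parDist k ≤ C k₁²` becomes a lower bound; the total
      -- exponent of `|k₁|` is then `2 - 3s ≥ -(1 + α)`.
      have h5 : C ^ (1 - s) * |(k 0 : ℝ)| ^ (2 - 2 * s) ≤ parDist k ^ (1 - s) := by
        have : |(k 0 : ℝ)| ^ (2 - 2 * s) = ((k 0 : ℝ) ^ 2) ^ (1 - s) := by
          rw [← sq_abs, ← Real.rpow_natCast, ← Real.rpow_mul hN0.le]
          congr 1
          push_cast
          ring
        rw [this, ← Real.mul_rpow (by positivity) (by positivity)]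
        exact Real.rpow_le_rpow_of_nonpos hM0 h2 (by linarith only [hs1])
      have h6 : (1 + |(k 0 : ℝ)|) ^ (-(1 + α)) ≤ |(k 0 : ℝ)| ^ (2 - 3 * s) :=
        calc (1 + |(k 0 : ℝ)|) ^ (-(1 + α)) ≤ |(k 0 : ℝ)| ^ (-(1 + α)) :=
              Real.rpow_le_rpow_of_nonpos hN0 (by linarith only) (by linarith only [hα])
          _ ≤ _ := Real.rpow_le_rpow_of_exponent_le hN (by linarith only [hs3])
      have h7 : |(k 0 : ℝ)| ^ (2 - 3 * s) = |(k 0 : ℝ)| ^ (2 - 2 * s) * |(k 0 : ℝ)| ^ (-s) := by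
        rw [← Real.rpow_add hN0]
        congr 1
        ring
      have h8 : parDist k ^ (1 - s) = parDist k * parDist k ^ (-s) := by
        rw [sub_eq_add_neg, Real.rpow_add hM0, Real.rpow_one]
      refine le_of_mul_le_mul_left ?_ (by linarith only [hν1] : (0 : ℝ) < ν + 1)
      calc (ν + 1) * (m * (1 + |(k 0 : ℝ)|) ^ (-(1 + α)))
          ≤ (ν + 1) * (c * C ^ (1 - s) / (ν + 1) * |(k 0 : ℝ)| ^ (2 - 3 * s)) := by
            gcongr
            exact (min_le_right _ _).trans (min_le_right _ _)
        _ = c * (C ^ (1 - s) * |(k 0 : ℝ)| ^ (2 - 2 * s)) * |(k 0 : ℝ)| ^ (-s) := by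
            rw [h7]
            field_simp
        _ ≤ c * parDist k ^ (1 - s) * |(k 0 : ℝ)| ^ (-s) := by gcongr
        _ = parDist k * (c * (|(k 0 : ℝ)| ^ (-s) * parDist k ^ (-s))) := by
            rw [h8]
            ring
        _ ≤ parDist k * |ν - resNu k| := by gcongr
        _ ≤ _ := h3
    · refine hred k 1 ((min_le_left _ _).trans (min_le_left _ _)) (le_trans ?_ h2.le)
      rw [← sq_abs]
      nlinarith only [hN]

/-- The frequencies at which the symbol of `𝔏₀` is small compared with `k₁²`. -/
def nearRes (ν τ : ℝ) : Set (Fin 2 → ℤ) :=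
  {k | 2 ≤ |(k 0 : ℝ)| ∧ |symbolL ν τ k| ≤ (4 * (ν + 1))⁻¹ * (k 0 : ℝ) ^ 2}

/-- Split `|L|⁻¹ = |L|^(-(1-δ)) |L|^(-δ)`. The first factor is compared with the Diophantine series,
the second with the pointwise lower bound; the losses are small powers of `|k₁|`, absorbed by the
spare `1/2` in the exponent `3/2`. -/
theorem summable_nearRes {α ν τ : ℝ} (hα : 0 < α) (hα1 : α ≤ 1) (hτ : 0 < τ)
    (hν : ν = √(1 + τ ^ 2)) (h : IsDiophantine (α / 14) ν) :
    Summable ((nearRes ν τ).indicator fun k =>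
      |(k 0 : ℝ)| ^ (-(3 / 2) : ℝ) * |symbolL ν τ k|⁻¹) := by
  have hν1 := one_lt_nu hτ hν
  obtain ⟨c, hc, hcb⟩ := exists_le_symbolL hα hα1 hτ hν h
  set δ := α / 14 with hδ
  have hδ0 : 0 < δ := by positivity
  have hδ1 : 14 * δ ≤ 1 := by linarith
  set C := 1 + (ν + 1) / τ with hC
  have hC1 : 1 ≤ C := le_add_of_nonneg_right (by positivity)
  set B := (ν + 1) ^ (1 - δ) * (c / 4) ^ (-δ) * C ^ (2 * δ)
  refine (h.summable.mul_left B).of_nonneg_of_le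
    (fun k => Set.indicator_nonneg (fun _ _ => by positivity) k) fun k => ?_
  have hnn : 0 ≤ B * (weight (1 + δ) k * |ν - resNu k| ^ (-(1 - δ))) :=
    mul_nonneg (by positivity) (mul_nonneg (weight_nonneg _ k) (by positivity))
  refine Set.indicator_apply_le' (fun hk => ?_) fun _ => hnn
  obtain ⟨hN, hL⟩ := hk
  have hN0 : 0 < |(k 0 : ℝ)| := by linarith
  have hsq : 0 < (k 0 : ℝ) ^ 2 := by
    rw [← sq_abs]
    positivity
  have h0 : k 0 ≠ 0 := by
    rintro h2
    simp [h2] at hN0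
  -- The threshold in `nearRes` excludes the parabolas: there it would give `k₁² - 1 ≤ k₁²/2`, false
  -- for `|k₁| ≥ 2`.
  have h1 : |k 1| ≠ k 0 ^ 2 := by
    intro h1
    have h2 := le_symbolL_on_parabola hτ hν h0 h1
    have h3 : 2 * (ν + 1) * |symbolL ν τ k| ≤ (k 0 : ℝ) ^ 2 / 2 :=
      calc _ ≤ 2 * (ν + 1) * ((4 * (ν + 1))⁻¹ * (k 0 : ℝ) ^ 2) := by gcongr
        _ = _ := by
          field_simp
          norm_num
    rw [← sq_abs] at h2 h3
    nlinarith
  have hker : k ∉ kerFreq := by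
    intro hk
    simp only [kerFreq, k0, k0star, Set.mem_insert_iff, Set.mem_singleton_iff] at hk
    rcases hk with rfl | rfl | rfl | rfl | rfl <;> norm_num at hN
  have hM := one_le_parDist h1
  have hM0 : 0 < parDist k := by linarith only [hM]
  have hx : 0 < |ν - resNu k| := abs_pos.2 (sub_ne_zero.2 (h.ne_resNu k))
  have h3 := parDist_mul_le hτ hν h0 h1
  have hMC : parDist k ≤ C * |(k 0 : ℝ)| ^ 2 := by
    rw [sq_abs]
    refine (parDist_le_or_lt_symbolL hτ k).resolve_right (not_lt.2 (hL.trans ?_))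
    refine mul_le_of_le_one_left hsq.le (inv_le_one_of_one_le₀ ?_)
    linarith
  have hL1 : c / 4 * |(k 0 : ℝ)| ^ (-2 : ℝ) ≤ |symbolL ν τ k| := by
    refine le_trans ?_ (hcb k hker)
    have h5 : (2 * |(k 0 : ℝ)|) ^ (-2 : ℝ) ≤ (1 + |(k 0 : ℝ)|) ^ (-(1 + α)) :=
      calc (2 * |(k 0 : ℝ)|) ^ (-2 : ℝ) ≤ (1 + |(k 0 : ℝ)|) ^ (-2 : ℝ) :=
            Real.rpow_le_rpow_of_nonpos (by linarith) (by linarith) (by norm_num)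
        _ ≤ _ := Real.rpow_le_rpow_of_exponent_le (by linarith) (by linarith)
    rw [Real.mul_rpow (by norm_num) hN0.le] at h5
    have h6 : (2 : ℝ) ^ (-2 : ℝ) = 1 / 4 := by
      rw [Real.rpow_neg (by norm_num)]
      norm_num
    rw [h6] at h5
    calc c / 4 * |(k 0 : ℝ)| ^ (-2 : ℝ) = c * (1 / 4 * |(k 0 : ℝ)| ^ (-2 : ℝ)) := by ring
      _ ≤ _ := by gcongr
  have hLpos : 0 < |symbolL ν τ k| := lt_of_lt_of_le (by positivity) hL1
  have hsplit : |symbolL ν τ k|⁻¹ = |symbolL ν τ k| ^ (-(1 - δ)) * |symbolL ν τ k| ^ (-δ) := by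
    rw [← Real.rpow_add hLpos, ← Real.rpow_neg_one]
    congr 1
    ring
  have hA : |symbolL ν τ k| ^ (-(1 - δ)) ≤
      (ν + 1) ^ (1 - δ) * (parDist k ^ (-(1 - δ)) * |ν - resNu k| ^ (-(1 - δ))) := by
    have h5 : (ν + 1)⁻¹ * (parDist k * |ν - resNu k|) ≤ |symbolL ν τ k| := by
      rwa [inv_mul_le_iff₀ (by linarith)]
    have h6 := Real.rpow_le_rpow_of_nonpos (by positivity) h5 (by linarith : -(1 - δ) ≤ 0)
    rwa [Real.mul_rpow (by positivity) (by positivity), Real.mul_rpow hM0.le hx.le,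
      Real.inv_rpow (by linarith), ← Real.rpow_neg (by linarith), neg_neg] at h6
  have hB : |symbolL ν τ k| ^ (-δ) ≤ (c / 4) ^ (-δ) * |(k 0 : ℝ)| ^ (2 * δ) := by
    have h6 := Real.rpow_le_rpow_of_nonpos (by positivity) hL1 (by linarith : -δ ≤ 0)
    rw [Real.mul_rpow (by positivity) (by positivity), ← Real.rpow_mul hN0.le] at h6
    convert h6 using 3
    ring
  have hD : parDist k ^ (-(1 - δ)) ≤
      parDist k ^ (-(1 + δ)) * (C ^ (2 * δ) * |(k 0 : ℝ)| ^ (4 * δ)) := by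
    have h6 : parDist k ^ (-(1 - δ)) = parDist k ^ (-(1 + δ)) * parDist k ^ (2 * δ) := by
      rw [← Real.rpow_add hM0]
      congr 1
      ring
    rw [h6]
    gcongr
    have h7 := Real.rpow_le_rpow hM0.le hMC (by linarith : 0 ≤ 2 * δ)
    rw [Real.mul_rpow (by positivity) (by positivity), ← Real.rpow_natCast,
      ← Real.rpow_mul hN0.le] at h7
    have h8 : ((2 : ℕ) : ℝ) * (2 * δ) = 4 * δ := by
      push_cast
      ring
    rwa [h8] at h7
  -- This needs `7δ ≤ 1/2`, whence the choice `δ = α/14`.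
  have hE : |(k 0 : ℝ)| ^ (-(3 / 2) : ℝ) * |(k 0 : ℝ)| ^ (2 * δ) * |(k 0 : ℝ)| ^ (4 * δ) ≤
      |(k 0 : ℝ)| ^ (-(1 + δ)) := by
    rw [← Real.rpow_add hN0, ← Real.rpow_add hN0]
    exact Real.rpow_le_rpow_of_exponent_le (by linarith) (by linarith)
  rw [hsplit]
  calc |(k 0 : ℝ)| ^ (-(3 / 2) : ℝ) * (|symbolL ν τ k| ^ (-(1 - δ)) * |symbolL ν τ k| ^ (-δ))
      ≤ |(k 0 : ℝ)| ^ (-(3 / 2) : ℝ) * (((ν + 1) ^ (1 - δ) *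
          ((parDist k ^ (-(1 + δ)) * (C ^ (2 * δ) * |(k 0 : ℝ)| ^ (4 * δ))) *
            |ν - resNu k| ^ (-(1 - δ)))) * ((c / 4) ^ (-δ) * |(k 0 : ℝ)| ^ (2 * δ))) := by
        refine mul_le_mul_of_nonneg_left (mul_le_mul (hA.trans ?_) hB (by positivity)
          (by positivity)) (by positivity)
        gcongr
    _ = B * ((|(k 0 : ℝ)| ^ (-(3 / 2) : ℝ) * |(k 0 : ℝ)| ^ (2 * δ) * |(k 0 : ℝ)| ^ (4 * δ)) *
          parDist k ^ (-(1 + δ)) * |ν - resNu k| ^ (-(1 - δ))) := by ring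
    _ ≤ B * (|(k 0 : ℝ)| ^ (-(1 + δ)) * parDist k ^ (-(1 + δ)) *
          |ν - resNu k| ^ (-(1 - δ))) := by gcongr
    _ = _ := rfl

/-! ### The kernel and the equation in Fourier coefficients. -/

theorem fourierCoef_eq_inner (u : L2) (k : Fin 2 → ℤ) : fourierCoef u k = inner ℂ (expFun k) u := by
  rw [← expBasis_repr, expBasis.repr_apply_apply, expBasis_apply]

theorem ext_fourierCoef {u v : L2} (h : ∀ k, fourierCoef u k = fourierCoef v k) : u = v := by
  apply expBasis.repr.injective
  ext k
  rw [expBasis_repr, expBasis_repr, h]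

theorem fourierCoef_expFun (l k : Fin 2 → ℤ) : fourierCoef (expFun l) k = if k = l then 1 else 0 := by
  rw [fourierCoef_eq_inner, ← expBasis_apply, ← expBasis_apply]
  exact orthonormal_iff_ite.1 expBasis.orthonormal k l

theorem fourierCoef_sub (u v : L2) (k : Fin 2 → ℤ) :
    fourierCoef (u - v) k = fourierCoef u k - fourierCoef v k := by
  simp only [fourierCoef_eq_inner, inner_sub_right]

theorem exists_fourierCoef_eq {a : (Fin 2 → ℤ) → ℂ} (ha : Summable fun k => ‖a k‖ ^ 2) :
    ∃ v : L2, ∀ k, fourierCoef v k = a k := by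
  have hm : Memℓp (E := fun _ : Fin 2 → ℤ => ℂ) a 2 := by
    rw [memℓp_gen_iff (by norm_num)]
    simpa using ha
  refine ⟨expBasis.repr.symm ⟨a, hm⟩, fun k => ?_⟩
  rw [← expBasis_repr, LinearIsometryEquiv.apply_symm_apply]

theorem summable_fourierCoef (u : L2) : Summable fun k => ‖fourierCoef u k‖ ^ 2 := by
  have h := (memℓp_gen_iff (E := fun _ : Fin 2 → ℤ => ℂ) (p := 2) (by norm_num)).1
    (lp.memℓp (expBasis.repr u))
  simpa [expBasis_repr] using h

theorem mem_kerL_iff {ν τ : ℝ} {u : L2} :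
    u ∈ kerL ν τ ↔ ∀ k, (symbolL ν τ k : ℂ) * fourierCoef u k = 0 := by
  constructor
  · rintro ⟨w, hw, rfl⟩ k
    rw [Submodule.subtype_apply, ← fourierCoef_opL]
    have : opL ν τ w = 0 := hw
    rw [this, fourierCoef_zero]
  · intro h
    have hd : u ∈ (opL ν τ).domain := by
      change InDomL ν τ u
      refine summable_zero.congr fun k => ?_
      have := congrArg (fun z : ℂ => ‖z‖ ^ 2) (h k)
      simpa [mul_pow] using this
    refine ⟨⟨u, hd⟩, ?_, rfl⟩
    change opL ν τ ⟨u, hd⟩ = 0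
    refine ext_fourierCoef fun k => ?_
    rw [fourierCoef_opL, fourierCoef_zero]
    exact h k

theorem expFun_mem_kerL {ν τ : ℝ} {l : Fin 2 → ℤ} (h : symbolL ν τ l = 0) :
    expFun l ∈ kerL ν τ := by
  rw [mem_kerL_iff]
  intro k
  rw [fourierCoef_expFun]
  split_ifs with hk
  · simp [hk, h]
  · simp

theorem mem_kerL_iff_of_ne {ν τ : ℝ} (h0 : ∀ k ∈ kerFreq, symbolL ν τ k = 0)
    (h1 : ∀ k, k ∉ kerFreq → symbolL ν τ k ≠ 0) {u : L2} :
    u ∈ kerL ν τ ↔ ∀ k, k ∉ kerFreq → fourierCoef u k = 0 := by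
  rw [mem_kerL_iff]
  refine forall_congr' fun k => ⟨fun h hk => ?_, fun h => ?_⟩
  · exact (mul_eq_zero.1 h).resolve_left (by exact_mod_cast h1 k hk)
  · by_cases hk : k ∈ kerFreq
    · simp [h0 k hk]
    · simp [h hk]

theorem kerFreq_finite : kerFreq.Finite := by
  unfold kerFreq
  exact Set.toFinite _

theorem kerL_eq_span_image {ν τ : ℝ} (h0 : ∀ k ∈ kerFreq, symbolL ν τ k = 0)
    (h1 : ∀ k, k ∉ kerFreq → symbolL ν τ k ≠ 0) :
    kerL ν τ = Submodule.span ℂ (expFun '' kerFreq) := by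
  refine le_antisymm (fun u hu => ?_) ?_
  · rw [mem_kerL_iff_of_ne h0 h1] at hu
    have hs : u = ∑ l ∈ kerFreq_finite.toFinset, fourierCoef u l • expFun l := by
      refine ext_fourierCoef fun k => ?_
      rw [fourierCoef_eq_inner (∑ l ∈ _, _), inner_sum]
      simp only [inner_smul_right, ← fourierCoef_eq_inner, fourierCoef_expFun, mul_ite, mul_one,
        mul_zero, Finset.sum_ite_eq]
      split_ifs with hk
      · rfl
      · exact hu k fun hk' => hk (kerFreq_finite.mem_toFinset.2 hk')
    rw [hs]
    exact Submodule.sum_mem _ fun l hl => Submodule.smul_mem _ _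
      (Submodule.subset_span ⟨l, kerFreq_finite.mem_toFinset.1 hl, rfl⟩)
  · rw [Submodule.span_le]
    rintro _ ⟨k, hk, rfl⟩
    exact expFun_mem_kerL (h0 k hk)

theorem mem_orthogonal_kerL_iff {ν τ : ℝ} (h0 : ∀ k ∈ kerFreq, symbolL ν τ k = 0)
    (h1 : ∀ k, k ∉ kerFreq → symbolL ν τ k ≠ 0) {u : L2} :
    u ∈ (kerL ν τ)ᗮ ↔ ∀ k ∈ kerFreq, fourierCoef u k = 0 := by
  rw [kerL_eq_span_image h0 h1, Submodule.mem_orthogonal]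
  constructor
  · intro h k hk
    rw [fourierCoef_eq_inner]
    exact h _ (Submodule.subset_span ⟨k, hk, rfl⟩)
  · intro h w hw
    induction hw using Submodule.span_induction with
    | mem x hx =>
      obtain ⟨k, hk, rfl⟩ := hx
      rw [← fourierCoef_eq_inner, h k hk]
    | zero => exact inner_zero_left _
    | add x y _ _ hx hy => rw [inner_add_left, hx, hy, add_zero]
    | smul a x _ hx => rw [inner_smul_left, hx, mul_zero]

theorem Solves.fourierCoef_eq {ν τ κ : ℝ} {v u : L2} (h : Solves ν τ κ v u) (k : Fin 2 → ℤ) :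
    ((symbolL ν τ k - κ : ℝ) : ℂ) * fourierCoef v k = fourierCoef u k := by
  obtain ⟨hd, rfl⟩ := h
  rw [fourierCoef_sub, fourierCoef_opL, fourierCoef_smul]
  push_cast
  ring

theorem solves_of_fourierCoef_eq {ν τ κ : ℝ} {v u : L2}
    (h : ∀ k, ((symbolL ν τ k - κ : ℝ) : ℂ) * fourierCoef v k = fourierCoef u k) :
    Solves ν τ κ v u := by
  have hmul : ∀ k, (symbolL ν τ k : ℂ) * fourierCoef v k = fourierCoef (u + (κ : ℂ) • v) k := by
    intro k
    rw [fourierCoef_add, fourierCoef_smul, ← h k]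
    push_cast
    ring
  have hd : v ∈ (opL ν τ).domain := by
    change InDomL ν τ v
    refine (summable_fourierCoef (u + (κ : ℂ) • v)).congr fun k => ?_
    rw [← hmul k]
    simp [mul_pow]
  refine ⟨hd, ext_fourierCoef fun k => ?_⟩
  rw [fourierCoef_sub, fourierCoef_opL, hmul k, fourierCoef_add, fourierCoef_smul]
  simp

theorem one_le_one_add_freqLength (k : Fin 2 → ℤ) : 1 ≤ 1 + freqLength k :=
  le_add_of_nonneg_right (Real.sqrt_nonneg _)

/-! ### Inverting a multiplier that is bounded below off the kernel frequencies. -/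

section Multiplier

variable {ν τ κ c β : ℝ} (hc : 0 < c)
  (hL : ∀ k, k ∉ kerFreq → c * (1 + freqLength k) ^ (-β) ≤ |symbolL ν τ k - κ|)
include hc hL

theorem symbol_sub_ne_zero {k : Fin 2 → ℤ} (hk : k ∉ kerFreq) : symbolL ν τ k - κ ≠ 0 := by
  have h1 := one_le_one_add_freqLength k
  have h2 : 0 < c * (1 + freqLength k) ^ (-β) := by positivity
  exact abs_pos.1 (h2.trans_le (hL k hk))

theorem norm_div_symbol_sq_le (s : ℝ) {a b : ℂ} {k : Fin 2 → ℤ} (hk : k ∉ kerFreq)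
    (h : ((symbolL ν τ k - κ : ℝ) : ℂ) * b = a) :
    (1 + freqLength k) ^ (2 * (s - β)) * ‖b‖ ^ 2 ≤
      (c⁻¹) ^ 2 * ((1 + freqLength k) ^ (2 * s) * ‖a‖ ^ 2) := by
  have h1 : 0 < 1 + freqLength k := by linarith [one_le_one_add_freqLength k]
  have h2 : (1 + freqLength k) ^ (-β) * ‖b‖ ≤ c⁻¹ * ‖a‖ := by
    rw [← h, norm_mul, Complex.norm_real, Real.norm_eq_abs, le_inv_mul_iff₀ hc, ← mul_assoc]
    gcongr
    exact hL k hk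
  have h3 : (1 + freqLength k) ^ (2 * (s - β)) =
      (1 + freqLength k) ^ (2 * s) * ((1 + freqLength k) ^ (-β)) ^ 2 := by
    rw [← Real.rpow_natCast _ 2, ← Real.rpow_mul h1.le, ← Real.rpow_add h1]
    congr 1
    push_cast
    ring
  calc (1 + freqLength k) ^ (2 * (s - β)) * ‖b‖ ^ 2
      = (1 + freqLength k) ^ (2 * s) * ((1 + freqLength k) ^ (-β) * ‖b‖) ^ 2 := by
        rw [h3]
        ring
    _ ≤ (1 + freqLength k) ^ (2 * s) * (c⁻¹ * ‖a‖) ^ 2 := by gcongr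
    _ = _ := by ring

theorem Solves.sobolev_bound {s : ℝ} {u v : L2} (hu : MemSobolev s u)
    (hv : ∀ k ∈ kerFreq, fourierCoef v k = 0) (h : Solves ν τ κ v u) :
    MemSobolev (s - β) v ∧ sobolevNorm (s - β) v ≤ c⁻¹ * sobolevNorm s u := by
  have hle : ∀ k, (1 + freqLength k) ^ (2 * (s - β)) * ‖fourierCoef v k‖ ^ 2 ≤
      (c⁻¹) ^ 2 * ((1 + freqLength k) ^ (2 * s) * ‖fourierCoef u k‖ ^ 2) := by
    intro k
    have h1 := one_le_one_add_freqLength k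
    by_cases hk : k ∈ kerFreq
    · rw [hv k hk]
      simp only [norm_zero, ne_eq, OfNat.ofNat_ne_zero, not_false_eq_true, zero_pow, mul_zero]
      positivity
    · exact norm_div_symbol_sq_le hc hL s hk (h.fourierCoef_eq k)
  have hsum : MemSobolev (s - β) v := by
    refine (hu.mul_left ((c⁻¹) ^ 2)).of_nonneg_of_le (fun k => ?_) hle
    have h1 := one_le_one_add_freqLength k
    positivity
  refine ⟨hsum, ?_⟩
  unfold sobolevNorm
  rw [Real.sqrt_le_left (mul_nonneg (by positivity) (Real.sqrt_nonneg _)), mul_pow, Real.sq_sqrt,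
    ← tsum_mul_left]
  · exact hsum.tsum_le_tsum hle (hu.mul_left _)
  · refine tsum_nonneg fun k => ?_
    have h1 := one_le_one_add_freqLength k
    positivity

theorem Solves.unique {u v v' : L2} (hv : ∀ k ∈ kerFreq, fourierCoef v k = 0)
    (hv' : ∀ k ∈ kerFreq, fourierCoef v' k = 0) (h : Solves ν τ κ v u) (h' : Solves ν τ κ v' u) :
    v = v' := by
  refine ext_fourierCoef fun k => ?_
  by_cases hk : k ∈ kerFreq
  · rw [hv k hk, hv' k hk]
  · have h1 : ((symbolL ν τ k - κ : ℝ) : ℂ) ≠ 0 := by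
      exact_mod_cast symbol_sub_ne_zero hc hL hk
    exact mul_left_cancel₀ h1 ((h.fourierCoef_eq k).trans (h'.fourierCoef_eq k).symm)

/-- Divide coefficientwise; `β ≤ s` makes the quotients square summable. At kernel frequencies both
sides vanish, whatever the value of the perturbed symbol there. -/
theorem exists_solves {s : ℝ} (hs : β ≤ s) {u : L2} (hu : MemSobolev s u)
    (hu0 : ∀ k ∈ kerFreq, fourierCoef u k = 0) :
    ∃ v : L2, (∀ k ∈ kerFreq, fourierCoef v k = 0) ∧ Solves ν τ κ v u := by
  classical
  set a : (Fin 2 → ℤ) → ℂ := fun k =>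
    if k ∈ kerFreq then 0 else fourierCoef u k / ((symbolL ν τ k - κ : ℝ) : ℂ) with ha
  have heq : ∀ k, ((symbolL ν τ k - κ : ℝ) : ℂ) * a k = fourierCoef u k := by
    intro k
    by_cases hk : k ∈ kerFreq
    · simp [ha, hk, hu0 k hk]
    · have h1 : ((symbolL ν τ k - κ : ℝ) : ℂ) ≠ 0 := by
        exact_mod_cast symbol_sub_ne_zero hc hL hk
      simp only [ha, if_neg hk]
      exact mul_div_cancel₀ _ h1
  have hsum : Summable fun k => ‖a k‖ ^ 2 := by
    refine (hu.mul_left ((c⁻¹) ^ 2)).of_nonneg_of_le (fun k => by positivity) fun k => ?_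
    have h1 := one_le_one_add_freqLength k
    by_cases hk : k ∈ kerFreq
    · simp only [ha, if_pos hk, norm_zero, ne_eq, OfNat.ofNat_ne_zero, not_false_eq_true, zero_pow]
      positivity
    · refine le_trans ?_ (norm_div_symbol_sq_le hc hL s hk (heq k))
      exact le_mul_of_one_le_left (by positivity) (Real.one_le_rpow h1 (by linarith))
  obtain ⟨v, hv⟩ := exists_fourierCoef_eq hsum
  refine ⟨v, fun k hk => ?_, solves_of_fourierCoef_eq fun k => ?_⟩
  · simp [hv, ha, hk]
  · rw [hv, heq]

end Multiplier

/-! ### Density at the origin and estimates for the perturbation. -/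

/-- If `B` has small measure near `0`, then its complement has full density at `0` with respect to
the weight `ε dε`. -/
theorem tendsto_setIntegral_diff_toMeasurable {B : Set ℝ} {r₁ : ℝ} (hr₁ : 0 < r₁) {g : ℝ → ℝ}
    (hg : Tendsto g (𝓝[>] 0) (𝓝 0))
    (hB : ∀ r, 0 < r → r < r₁ → volume (B ∩ Set.Icc 0 r) ≤ ENNReal.ofReal (r * g r)) :
    Tendsto (fun r : ℝ => 2 / r ^ 2 *
      ∫ ε in Set.Icc 0 r ∩ (Set.Ico 0 r₁ \ toMeasurable volume B), ε) (𝓝[>] 0) (𝓝 1) := by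
  have h1 : ∀ᶠ r : ℝ in 𝓝[>] 0, 0 < r ∧ r < r₁ := Ioo_mem_nhdsGT hr₁
  have h2 : ∀ᶠ r : ℝ in 𝓝[>] 0,
      ‖2 / r ^ 2 * (∫ ε in Set.Icc 0 r ∩ (Set.Ico 0 r₁ \ toMeasurable volume B), ε) - 1‖ ≤
        2 * |g r| := by
    filter_upwards [h1] with r ⟨hr, hrr⟩
    set T := toMeasurable volume B
    have hset : Set.Icc 0 r ∩ (Set.Ico 0 r₁ \ T) = Set.Icc 0 r \ T := by
      ext x
      simp only [Set.mem_inter_iff, Set.mem_Icc, Set.mem_sdiff, Set.mem_Ico]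
      constructor
      · rintro ⟨h3, _, h4⟩
        exact ⟨h3, h4⟩
      · rintro ⟨h3, h4⟩
        exact ⟨h3, ⟨h3.1, h3.2.trans_lt hrr⟩, h4⟩
    have hint : IntegrableOn (fun ε : ℝ => ε) (Set.Icc 0 r) volume :=
      continuous_id.continuousOn.integrableOn_Icc
    have hsplit := integral_inter_add_sdiff (measurableSet_toMeasurable volume B) hint
    have hI : ∫ ε in Set.Icc 0 r, ε = r ^ 2 / 2 := by
      rw [integral_Icc_eq_integral_Ioc, ← intervalIntegral.integral_of_le hr.le, integral_id]
      ring
    -- The measurable hull has the same measure as `B` inside each interval, so `B` itself need not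
    -- be measurable.
    have hvol : volume (Set.Icc 0 r ∩ T) ≤ ENNReal.ofReal (r * |g r|) := by
      rw [Set.inter_comm, Measure.measure_toMeasurable_inter_of_sFinite measurableSet_Icc]
      refine (hB r hr hrr).trans (ENNReal.ofReal_le_ofReal ?_)
      exact mul_le_mul_of_nonneg_left (le_abs_self _) hr.le
    have hsmall : ‖∫ ε in Set.Icc 0 r ∩ T, ε‖ ≤ r * (r * |g r|) := by
      refine (norm_setIntegral_le_of_norm_le_const (C := r)
        (hvol.trans_lt ENNReal.ofReal_lt_top) fun x hx => ?_).trans ?_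
      · rw [Real.norm_eq_abs, abs_of_nonneg hx.1.1]
        exact hx.1.2
      · refine mul_le_mul_of_nonneg_left ?_ hr.le
        exact ENNReal.toReal_le_of_le_ofReal (by positivity) hvol
    rw [hset]
    have heq : 2 / r ^ 2 * (∫ ε in Set.Icc 0 r \ T, ε) - 1 =
        -(2 / r ^ 2) * ∫ ε in Set.Icc 0 r ∩ T, ε := by
      rw [hI] at hsplit
      rw [← eq_sub_iff_add_eq'] at hsplit
      rw [hsplit]
      field_simp
      ring
    rw [heq, norm_mul, norm_neg, Real.norm_of_nonneg (by positivity)]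
    calc 2 / r ^ 2 * ‖∫ ε in Set.Icc 0 r ∩ T, ε‖ ≤ 2 / r ^ 2 * (r * (r * |g r|)) := by gcongr
      _ = 2 * |g r| := by field_simp
  rw [← tendsto_sub_nhds_zero_iff]
  refine squeeze_zero_norm' h2 ?_
  simpa using (hg.abs.const_mul 2)

/-- An exponential in `√n` beats `n⁴ ≤ (⌊√n⌋ + 1)⁸`. With `n = |k₁|` this makes the change of the
symbol beyond index `m + ⌊√n⌋` negligible against `1/k₁²`. -/
theorem exists_mul_pow_four_le_two_pow {A : ℝ} (hA : 0 < A) :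
    ∃ m : ℕ, 1 ≤ m ∧ ∀ n : ℕ, A * (n : ℝ) ^ 4 ≤ 2 ^ (m + Nat.sqrt n) := by
  obtain ⟨B, hB⟩ := (tendsto_pow_const_div_const_pow_of_one_lt 8
    (by norm_num : (1 : ℝ) < 2)).bddAbove_range
  obtain ⟨m, hm⟩ := pow_unbounded_of_one_lt (A * (2 * B)) (by norm_num : (1 : ℝ) < 2)
  refine ⟨m + 1, by omega, fun n => ?_⟩
  have h1 : (n : ℝ) ≤ ((Nat.sqrt n + 1 : ℕ) : ℝ) ^ 2 := by
    have := (Nat.lt_succ_sqrt' n).le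
    exact_mod_cast this
  have h2 : ((Nat.sqrt n + 1 : ℕ) : ℝ) ^ 8 ≤ B * 2 ^ (Nat.sqrt n + 1) := by
    have := hB ⟨Nat.sqrt n + 1, rfl⟩
    rwa [div_le_iff₀ (by positivity)] at this
  calc A * (n : ℝ) ^ 4 ≤ A * (((Nat.sqrt n + 1 : ℕ) : ℝ) ^ 2) ^ 4 := by gcongr
    _ = A * ((Nat.sqrt n + 1 : ℕ) : ℝ) ^ 8 := by ring
    _ ≤ A * (B * 2 ^ (Nat.sqrt n + 1)) := by gcongr
    _ = A * (2 * B) * 2 ^ Nat.sqrt n := by ring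
    _ ≤ 2 ^ m * 2 ^ Nat.sqrt n := by gcongr
    _ ≤ 2 ^ (m + 1) * 2 ^ Nat.sqrt n := by
      gcongr
      · norm_num
      · omega
    _ = _ := by rw [← pow_add]

theorem abs_perturbation_le {n x y R ε : ℝ} (N : ℝ) (hxy : |x| + |y| ≤ R) (h0 : 0 ≤ ε)
    (h1 : ε ≤ 1) :
    |N ^ 2 * (ε ^ 2 * n - ε ^ 3 * x) - ε ^ 2 * y| ≤ (|n| + R) * (1 + N ^ 2) * ε ^ 2 := by
  have hx : |x| ≤ R := by linarith [abs_nonneg y]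
  have hy : |y| ≤ R := by linarith [abs_nonneg x]
  have h3 : ε ^ 3 ≤ ε ^ 2 := pow_le_pow_of_le_one h0 h1 (by norm_num)
  calc |N ^ 2 * (ε ^ 2 * n - ε ^ 3 * x) - ε ^ 2 * y|
      ≤ |N ^ 2 * (ε ^ 2 * n - ε ^ 3 * x)| + |ε ^ 2 * y| := abs_sub _ _
    _ = N ^ 2 * |ε ^ 2 * n - ε ^ 3 * x| + ε ^ 2 * |y| := by
        rw [abs_mul, abs_mul, abs_of_nonneg (sq_nonneg N), abs_of_nonneg (sq_nonneg ε)]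
    _ ≤ N ^ 2 * (ε ^ 2 * |n| + ε ^ 2 * R) + ε ^ 2 * R := by
        gcongr
        refine (abs_sub _ _).trans ?_
        rw [abs_mul, abs_mul, abs_of_nonneg (sq_nonneg ε), abs_of_nonneg (pow_nonneg h0 3)]
        gcongr
    _ ≤ _ := by nlinarith [mul_nonneg (abs_nonneg n) (sq_nonneg ε)]

/-- The perturbation expands distances measured in `ε²`. -/
theorem le_abs_perturbation_sub {n x y x' y' R ε ε' r₁ N : ℝ} (hxy : |x| + |y| ≤ R)
    (hd : |x - x'| + |y - y'| ≤ R * |ε - ε'|) (h0 : 0 ≤ ε) (h0' : 0 ≤ ε')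
    (h1 : ε ≤ r₁) (h1' : ε' ≤ r₁) (hr1 : r₁ ≤ 1) (hr : 3 * R * r₁ ≤ |n| / 4)
    (hN : 2 * R ≤ N ^ 2 * |n| / 4) :
    N ^ 2 * |n| / 2 * |ε ^ 2 - ε' ^ 2| ≤
      |(N ^ 2 * (ε ^ 2 * n - ε ^ 3 * x) - ε ^ 2 * y) -
        (N ^ 2 * (ε' ^ 2 * n - ε' ^ 3 * x') - ε' ^ 2 * y')| := by
  have hx : |x| ≤ R := by linarith [abs_nonneg y]
  have hy : |y| ≤ R := by linarith [abs_nonneg x]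
  have hR : 0 ≤ R := (abs_nonneg x).trans hx
  have hr0 : 0 ≤ r₁ := h0.trans h1
  have hdx : |x - x'| ≤ R * |ε - ε'| := by linarith [abs_nonneg (y - y')]
  have hdy : |y - y'| ≤ R * |ε - ε'| := by linarith [abs_nonneg (x - x')]
  have hsq : |ε ^ 2 - ε' ^ 2| = |ε - ε'| * (ε + ε') := by
    rw [← abs_of_nonneg (add_nonneg h0 h0'), ← abs_mul]
    ring_nf
  have hcube : |ε ^ 3 - ε' ^ 3| ≤ 2 * r₁ * |ε ^ 2 - ε' ^ 2| := by
    have h3 : |ε ^ 3 - ε' ^ 3| = |ε - ε'| * (ε ^ 2 + ε * ε' + ε' ^ 2) := by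
      rw [← abs_of_nonneg (by positivity : 0 ≤ ε ^ 2 + ε * ε' + ε' ^ 2), ← abs_mul]
      ring_nf
    rw [h3, hsq]
    calc |ε - ε'| * (ε ^ 2 + ε * ε' + ε' ^ 2) ≤ |ε - ε'| * (2 * r₁ * (ε + ε')) := by
          gcongr
          nlinarith
      _ = _ := by ring
  have hX : |ε ^ 3 * x - ε' ^ 3 * x'| ≤ 3 * R * r₁ * |ε ^ 2 - ε' ^ 2| := by
    have h3 : ε ^ 3 * x - ε' ^ 3 * x' = (ε ^ 3 - ε' ^ 3) * x + ε' ^ 3 * (x - x') := by ring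
    have h4 : ε' ^ 3 * (R * |ε - ε'|) ≤ R * r₁ * |ε ^ 2 - ε' ^ 2| := by
      rw [hsq]
      have h5 : ε' ^ 3 ≤ r₁ * (ε + ε') := by nlinarith [mul_nonneg h0' h0', mul_nonneg h0' h0]
      calc ε' ^ 3 * (R * |ε - ε'|) ≤ r₁ * (ε + ε') * (R * |ε - ε'|) := by gcongr
        _ = _ := by ring
    calc |ε ^ 3 * x - ε' ^ 3 * x'| ≤ |ε ^ 3 - ε' ^ 3| * |x| + ε' ^ 3 * |x - x'| := by
          rw [h3]
          refine (abs_add_le _ _).trans ?_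
          rw [abs_mul, abs_mul, abs_of_nonneg (pow_nonneg h0' 3)]
      _ ≤ 2 * r₁ * |ε ^ 2 - ε' ^ 2| * R + ε' ^ 3 * (R * |ε - ε'|) := by gcongr
      _ ≤ _ := by linarith
  have hY : |ε ^ 2 * y - ε' ^ 2 * y'| ≤ 2 * R * |ε ^ 2 - ε' ^ 2| := by
    have h3 : ε ^ 2 * y - ε' ^ 2 * y' = (ε ^ 2 - ε' ^ 2) * y + ε' ^ 2 * (y - y') := by ring
    have h4 : ε' ^ 2 * (R * |ε - ε'|) ≤ R * |ε ^ 2 - ε' ^ 2| := by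
      rw [hsq]
      have h5 : ε' ^ 2 ≤ ε + ε' := by nlinarith
      calc ε' ^ 2 * (R * |ε - ε'|) ≤ (ε + ε') * (R * |ε - ε'|) := by gcongr
        _ = _ := by ring
    calc |ε ^ 2 * y - ε' ^ 2 * y'| ≤ |ε ^ 2 - ε' ^ 2| * |y| + ε' ^ 2 * |y - y'| := by
          rw [h3]
          refine (abs_add_le _ _).trans ?_
          rw [abs_mul, abs_mul, abs_of_nonneg (sq_nonneg ε')]
      _ ≤ |ε ^ 2 - ε' ^ 2| * R + ε' ^ 2 * (R * |ε - ε'|) := by gcongr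
      _ ≤ _ := by linarith
  set D := (N ^ 2 * (ε ^ 2 * n - ε ^ 3 * x) - ε ^ 2 * y) -
        (N ^ 2 * (ε' ^ 2 * n - ε' ^ 3 * x') - ε' ^ 2 * y') with hD
  -- The term linear in `ε²` dominates: small `r₁` limits the cubic term to a quarter of it, large
  -- `N` limits the `ϰ` term to another quarter, and half survives.
  have hmain : N ^ 2 * |n| * |ε ^ 2 - ε' ^ 2| ≤
      |D| + N ^ 2 * |ε ^ 3 * x - ε' ^ 3 * x'| + |ε ^ 2 * y - ε' ^ 2 * y'| := by
    have h3 : N ^ 2 * n * (ε ^ 2 - ε' ^ 2) =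
        D + N ^ 2 * (ε ^ 3 * x - ε' ^ 3 * x') + (ε ^ 2 * y - ε' ^ 2 * y') := by
      rw [hD]
      ring
    calc N ^ 2 * |n| * |ε ^ 2 - ε' ^ 2| = |N ^ 2 * n * (ε ^ 2 - ε' ^ 2)| := by
          rw [abs_mul, abs_mul, abs_of_nonneg (sq_nonneg N)]
      _ ≤ _ := by
          rw [h3]
          refine (abs_add_three _ _ _).trans ?_
          rw [abs_mul (N ^ 2), abs_of_nonneg (sq_nonneg N)]
  have h5 : N ^ 2 * |ε ^ 3 * x - ε' ^ 3 * x'| ≤ N ^ 2 * (|n| / 4 * |ε ^ 2 - ε' ^ 2|) := by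
    gcongr
    exact hX.trans (by gcongr)
  have h6 : |ε ^ 2 * y - ε' ^ 2 * y'| ≤ N ^ 2 * |n| / 4 * |ε ^ 2 - ε' ^ 2| :=
    hY.trans (by gcongr)
  linarith

/-- Telescoping of a geometric series; the subtracted term makes the induction close exactly. -/
theorem PerturbationBounds.abs_sub_le {r₀ R : ℝ} {nuT kaT : ℕ → ℝ → ℝ}
    (h : PerturbationBounds r₀ R nuT kaT) {J j : ℕ} (hJ : 1 ≤ J) (hj : J ≤ j) {ε : ℝ}
    (hε : ε ∈ Set.Icc 0 r₀) :
    |nuT j ε - nuT J ε| + |kaT j ε - kaT J ε| ≤ 2 * R / 2 ^ J - 2 * R / 2 ^ j := by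
  induction j, hj using Nat.le_induction with
  | base => simp
  | succ i hi ih =>
    have h1 := h.cauchy i (hJ.trans hi) ε hε
    have h2 : 2 * R / 2 ^ (i + 1) = 2 * R / 2 ^ i - R / 2 ^ i := by
      field_simp
      ring
    have h3 := _root_.abs_sub_le (nuT (i + 1) ε) (nuT i ε) (nuT J ε)
    have h4 := _root_.abs_sub_le (kaT (i + 1) ε) (kaT i ε) (kaT J ε)
    linarith

/-! ### Measure of the bad parameters. -/

/-- The symbol of `𝔏 - ϰ` at the perturbed parameters. -/
noncomputable def pertSymbol (ν τ : ℝ) (nuT kaT : ℕ → ℝ → ℝ) (j : ℕ) (ε : ℝ) (k : Fin 2 → ℤ) : ℝ :=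
  symbolL (nuPert ν τ nuT j ε) τ k - kaPert kaT j ε

theorem pertSymbol_eq (ν τ : ℝ) (nuT kaT : ℕ → ℝ → ℝ) (j : ℕ) (ε : ℝ) (k : Fin 2 → ℤ) :
    pertSymbol ν τ nuT kaT j ε k = symbolL ν τ k +
      ((k 0 : ℝ) ^ 2 * (ε ^ 2 * nuOne τ - ε ^ 3 * nuT j ε) - ε ^ 2 * kaT j ε) := by
  unfold pertSymbol symbolL nuPert kaPert
  ring

/-- The parameters `ε` for which the perturbed symbol at `k` is too small. -/
def badSet (ν τ : ℝ) (nuT kaT : ℕ → ℝ → ℝ) (r₁ c : ℝ) (k : Fin 2 → ℤ) (j : ℕ) : Set ℝ :=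
  {ε | ε ∈ Set.Icc 0 r₁ ∧ |pertSymbol ν τ nuT kaT j ε k| < 2 * c / (k 0 : ℝ) ^ 2}

section Bad

variable {ν τ r₀ r₁ R c : ℝ} {nuT kaT : ℕ → ℝ → ℝ}

theorem abs_pertSymbol_sub_le (hP : PerturbationBounds r₀ R nuT kaT) {j : ℕ} (hj : 1 ≤ j) {ε : ℝ}
    (h0 : 0 ≤ ε) (hr : ε ≤ r₀) (h1 : ε ≤ 1) (k : Fin 2 → ℤ) :
    |pertSymbol ν τ nuT kaT j ε k - symbolL ν τ k| ≤
      (|nuOne τ| + R) * (1 + (k 0 : ℝ) ^ 2) * ε ^ 2 := by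
  rw [pertSymbol_eq, add_sub_cancel_left]
  exact abs_perturbation_le _ (hP.bounded j hj ε ⟨h0, hr⟩) h0 h1

theorem abs_pertSymbol_sub_pertSymbol_le (hP : PerturbationBounds r₀ R nuT kaT) (hR : 0 < R)
    {J j : ℕ} (hJ : 1 ≤ J) (hj : J ≤ j) {ε : ℝ} (h0 : 0 ≤ ε) (hr : ε ≤ r₀) (h1 : ε ≤ 1)
    {k : Fin 2 → ℤ} (hk : 1 ≤ (k 0 : ℝ) ^ 2) :
    |pertSymbol ν τ nuT kaT j ε k - pertSymbol ν τ nuT kaT J ε k| ≤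
      (k 0 : ℝ) ^ 2 * (2 * R / 2 ^ J) := by
  have h2 := hP.abs_sub_le hJ hj ⟨h0, hr⟩
  have h3 : 0 ≤ 2 * R / 2 ^ j := by positivity
  have h4 : pertSymbol ν τ nuT kaT j ε k - pertSymbol ν τ nuT kaT J ε k =
      -((k 0 : ℝ) ^ 2 * ε ^ 3 * (nuT j ε - nuT J ε) + ε ^ 2 * (kaT j ε - kaT J ε)) := by
    rw [pertSymbol_eq, pertSymbol_eq]
    ring
  rw [h4, abs_neg]
  calc _ ≤ (k 0 : ℝ) ^ 2 * ε ^ 3 * |nuT j ε - nuT J ε| + ε ^ 2 * |kaT j ε - kaT J ε| := by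
        refine (abs_add_le _ _).trans ?_
        rw [abs_mul, abs_mul (ε ^ 2), abs_of_nonneg (by positivity : 0 ≤ (k 0 : ℝ) ^ 2 * ε ^ 3),
          abs_of_nonneg (sq_nonneg ε)]
    _ ≤ (k 0 : ℝ) ^ 2 * 1 * |nuT j ε - nuT J ε| + (k 0 : ℝ) ^ 2 * |kaT j ε - kaT J ε| := by
        refine add_le_add ?_
          (mul_le_mul_of_nonneg_right ((pow_le_one₀ h0 h1).trans hk) (abs_nonneg _))
        gcongr
        exact pow_le_one₀ h0 h1
    _ = (k 0 : ℝ) ^ 2 * (|nuT j ε - nuT J ε| + |kaT j ε - kaT J ε|) := by ring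
    _ ≤ _ := by
        gcongr
        linarith

/-- Two bad parameters have nearby perturbed symbols, hence nearby squares by the expansion
estimate. Bad parameters also stay away from `0`, which turns closeness of squares into closeness of
the parameters and bounds the diameter. -/
theorem volume_badSet_inter_le (hP : PerturbationBounds r₀ R nuT kaT) (hR : 0 < R)
    (hn : nuOne τ ≠ 0) (hr₁ : r₁ ≤ r₀) (hr1 : r₁ ≤ 1) (hrR : 3 * R * r₁ ≤ |nuOne τ| / 4) (hc : 0 < c)
    {k : Fin 2 → ℤ} (hk : 1 ≤ (k 0 : ℝ) ^ 2) (hkR : 2 * R ≤ (k 0 : ℝ) ^ 2 * |nuOne τ| / 4)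
    (hL : 4 * c / (k 0 : ℝ) ^ 2 ≤ |symbolL ν τ k|) {j : ℕ} (hj : 1 ≤ j) {r : ℝ} (hr : 0 < r) :
    volume (badSet ν τ nuT kaT r₁ c k j ∩ Set.Icc 0 r) ≤
      ENNReal.ofReal (if |symbolL ν τ k| ≤ 4 * (|nuOne τ| + R) * r ^ 2 * (k 0 : ℝ) ^ 2 then
        16 * c * (|nuOne τ| + R) / |nuOne τ| * r * (((k 0 : ℝ) ^ 2)⁻¹ * |symbolL ν τ k|⁻¹)
        else 0) := by
  have hn0 : 0 < |nuOne τ| := abs_pos.2 hn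
  set n := |nuOne τ| with hndef
  set N2 := (k 0 : ℝ) ^ 2 with hN2
  set K := n + R with hK
  set ℓ := |symbolL ν τ k| with hℓ
  have hK0 : 0 < K := by positivity
  have hN0 : 0 < N2 := by linarith
  have hℓ0 : 0 < ℓ := lt_of_lt_of_le (by positivity) hL
  -- The bad threshold is at most `ℓ/2`, so the perturbation, of size at most `2 K N2 ε²`, must
  -- cancel at least half of the symbol.
  have hlow : ∀ ε ∈ badSet ν τ nuT kaT r₁ c k j, ℓ ≤ 4 * K * ε ^ 2 * N2 := by
    rintro ε ⟨⟨h0, h1⟩, h2⟩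
    have h3 := abs_pertSymbol_sub_le (ν := ν) (τ := τ) hP hj h0 (h1.trans hr₁) (h1.trans hr1) k
    have h4 := abs_sub_abs_le_abs_sub (symbolL ν τ k) (pertSymbol ν τ nuT kaT j ε k)
    rw [abs_sub_comm] at h4
    have h5 : K * (1 + N2) * ε ^ 2 ≤ K * (2 * N2) * ε ^ 2 := by
      gcongr
      linarith
    have h6 : 4 * c / N2 = 2 * (2 * c / N2) := by ring
    linarith
  rcases Set.eq_empty_or_nonempty (badSet ν τ nuT kaT r₁ c k j ∩ Set.Icc 0 r) with he | ⟨e, he⟩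
  · simp [he]
  have hle : ℓ ≤ 4 * K * r ^ 2 * N2 := (hlow e he.1).trans (by
    have := he.2.1
    have := he.2.2
    gcongr)
  rw [if_pos hle]
  refine (Real.volume_le_diam _).trans (Metric.ediam_le fun ε hε ε' hε' => ?_)
  rw [edist_dist]
  apply ENNReal.ofReal_le_ofReal
  rw [Real.dist_eq]
  -- Using `ε² ≤ ε r` keeps this linear in `ℓ`, so that only `ℓ⁻¹` enters the final length.
  have hge : ∀ ε ∈ badSet ν τ nuT kaT r₁ c k j ∩ Set.Icc 0 r, ℓ / (4 * K * N2 * r) ≤ ε := by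
    intro ε hε
    have h1 := hlow ε hε.1
    have h2 := hε.2.1
    have h3 := hε.2.2
    rw [div_le_iff₀ (by positivity)]
    calc ℓ ≤ 4 * K * ε ^ 2 * N2 := h1
      _ = ε * (4 * K * N2 * ε) := by ring
      _ ≤ _ := by gcongr
  have h1 := hge ε hε
  have h2 := hge ε' hε'
  obtain ⟨⟨⟨e0, e1⟩, e2⟩, -⟩ := hε
  obtain ⟨⟨⟨e0', e1'⟩, e2'⟩, -⟩ := hε'
  have hb := hP.bounded j hj ε ⟨e0, e1.trans hr₁⟩
  have hl := hP.lipschitz j hj ε ⟨e0, e1.trans hr₁⟩ ε' ⟨e0', e1'.trans hr₁⟩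
  have h3 := le_abs_perturbation_sub hb hl e0 e0' e1 e1' hr1 hrR hkR
  have h4 : |(N2 * (ε ^ 2 * nuOne τ - ε ^ 3 * nuT j ε) - ε ^ 2 * kaT j ε) -
      (N2 * (ε' ^ 2 * nuOne τ - ε' ^ 3 * nuT j ε') - ε' ^ 2 * kaT j ε')| ≤ 4 * c / N2 := by
    have h5 := abs_sub (pertSymbol ν τ nuT kaT j ε k) (pertSymbol ν τ nuT kaT j ε' k)
    have h6 : pertSymbol ν τ nuT kaT j ε k - pertSymbol ν τ nuT kaT j ε' k =
        (N2 * (ε ^ 2 * nuOne τ - ε ^ 3 * nuT j ε) - ε ^ 2 * kaT j ε) -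
        (N2 * (ε' ^ 2 * nuOne τ - ε' ^ 3 * nuT j ε') - ε' ^ 2 * kaT j ε') := by
      rw [pertSymbol_eq, pertSymbol_eq]
      ring
    rw [h6] at h5
    have h7 : 4 * c / N2 = 2 * c / N2 + 2 * c / N2 := by ring
    linarith
  have hsq : |ε ^ 2 - ε' ^ 2| = |ε - ε'| * (ε + ε') := by
    rw [← abs_of_nonneg (add_nonneg e0 e0'), ← abs_mul]
    ring_nf
  have h5 : N2 * n / 2 * (|ε - ε'| * (2 * (ℓ / (4 * K * N2 * r)))) ≤ 4 * c / N2 := by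
    refine le_trans ?_ (h3.trans h4)
    rw [hsq]
    gcongr
    linarith
  have h6 : N2 * n / 2 * (|ε - ε'| * (2 * (ℓ / (4 * K * N2 * r)))) =
      |ε - ε'| * (n * ℓ / (4 * K * r)) := by
    field_simp
  rw [h6, ← le_div_iff₀ (by positivity)] at h5
  refine h5.trans (le_of_eq ?_)
  field_simp
  norm_num

/-- All bad parameters: frequencies with `|k₁| ≥ N₀` and indices `j` up to order `√|k₁|`. -/
def badUnion (ν τ : ℝ) (nuT kaT : ℕ → ℝ → ℝ) (r₁ c N₀ : ℝ) (m : ℕ) : Set ℝ :=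
  ⋃ k : Fin 2 → ℤ, {ε | N₀ ≤ |(k 0 : ℝ)| ∧
    ε ∈ ⋃ j ∈ Finset.Icc 1 (m + Nat.sqrt (k 0).natAbs), badSet ν τ nuT kaT r₁ c k j}

/-- The terms of the small divisor series that matter for parameters `ε ≤ r`. -/
noncomputable def resTerm (ν τ K r : ℝ) (k : Fin 2 → ℤ) : ℝ :=
  {k : Fin 2 → ℤ | |symbolL ν τ k| ≤ K * r ^ 2 * (k 0 : ℝ) ^ 2}.indicator
    ((nearRes ν τ).indicator fun k => |(k 0 : ℝ)| ^ (-(3 / 2) : ℝ) * |symbolL ν τ k|⁻¹) k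

theorem resTerm_nonneg (K r : ℝ) (k : Fin 2 → ℤ) : 0 ≤ resTerm ν τ K r k :=
  Set.indicator_nonneg (fun _ _ => Set.indicator_nonneg (fun _ _ => by positivity) _) _

theorem resTerm_le (K r : ℝ) (k : Fin 2 → ℤ) : resTerm ν τ K r k ≤
    (nearRes ν τ).indicator (fun k => |(k 0 : ℝ)| ^ (-(3 / 2) : ℝ) * |symbolL ν τ k|⁻¹) k :=
  Set.indicator_le_self' (fun _ _ => Set.indicator_nonneg (fun _ _ => by positivity) _) _

/-- Dominated convergence: a fixed `k` with `L(k) ≠ 0` drops out once `r` is small, and if `L(k) =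
0` the term is zero because `0⁻¹ = 0`. -/
theorem tendsto_tsum_resTerm {K : ℝ} (hs : Summable ((nearRes ν τ).indicator fun k =>
      |(k 0 : ℝ)| ^ (-(3 / 2) : ℝ) * |symbolL ν τ k|⁻¹)) :
    Tendsto (fun r => ∑' k, resTerm ν τ K r k) (𝓝[>] 0) (𝓝 0) := by
  have h : Tendsto (fun r => ∑' k, resTerm ν τ K r k) (𝓝[>] 0)
      (𝓝 (∑' _ : Fin 2 → ℤ, (0 : ℝ))) := by
    refine tendsto_tsum_of_dominated_convergence hs (fun k => ?_)
      (Eventually.of_forall fun r k => ?_)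
    · rcases eq_or_ne (symbolL ν τ k) 0 with h0 | h0
      · refine tendsto_const_nhds.congr fun r => ?_
        refine le_antisymm (resTerm_nonneg _ _ _) ((resTerm_le _ _ _).trans_eq ?_)
        exact Set.indicator_apply_eq_zero.2 fun _ => by rw [h0, abs_zero, inv_zero, mul_zero]
      · have hlim : Tendsto (fun r : ℝ => K * r ^ 2 * (k 0 : ℝ) ^ 2) (𝓝[>] 0) (𝓝 0) := by
          have : Continuous fun r : ℝ => K * r ^ 2 * (k 0 : ℝ) ^ 2 := by fun_prop
          refine (this.tendsto' 0 0 (by simp)).mono_left nhdsWithin_le_nhds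
        refine tendsto_const_nhds.congr' ?_
        filter_upwards [hlim.eventually_lt_const (abs_pos.2 h0)] with r hr
        rw [resTerm, Set.indicator_of_notMem]
        exact not_le.2 hr
    · rw [Real.norm_of_nonneg (resTerm_nonneg _ _ _)]
      exact resTerm_le _ _ _
  simpa using h

/-- A union bound. The `m + ⌊√|k₁|⌋` indices cost a factor `|k₁|^(1/2)`, which turns `k₁⁻²` into
`|k₁|^(-3/2)`. -/
theorem volume_badUnion_inter_le (hP : PerturbationBounds r₀ R nuT kaT) (hR : 0 < R)
    (hn : nuOne τ ≠ 0) (hr₁ : r₁ ≤ r₀) (hr1 : r₁ ≤ 1) (hrR : 3 * R * r₁ ≤ |nuOne τ| / 4)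
    (hrν : 4 * (|nuOne τ| + R) * r₁ ^ 2 ≤ (4 * (ν + 1))⁻¹) (hc : 0 < c) {N₀ : ℝ} (hN₀ : 2 ≤ N₀)
    (hN₀R : 2 * R ≤ N₀ ^ 2 * |nuOne τ| / 4)
    (hL : ∀ k : Fin 2 → ℤ, N₀ ≤ |(k 0 : ℝ)| → 4 * c / (k 0 : ℝ) ^ 2 ≤ |symbolL ν τ k|) {m : ℕ}
    (hs : Summable ((nearRes ν τ).indicator fun k =>
      |(k 0 : ℝ)| ^ (-(3 / 2) : ℝ) * |symbolL ν τ k|⁻¹)) {r : ℝ} (hr : 0 < r) (hrr : r < r₁) :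
    volume (badUnion ν τ nuT kaT r₁ c N₀ m ∩ Set.Icc 0 r) ≤
      ENNReal.ofReal (r * ((m + 1) * (16 * c * (|nuOne τ| + R) / |nuOne τ|) *
        ∑' k, resTerm ν τ (4 * (|nuOne τ| + R)) r k)) := by
  have hn0 : 0 < |nuOne τ| := abs_pos.2 hn
  set K := |nuOne τ| + R with hK
  have hK0 : 0 < K := by positivity
  set A := 16 * c * K / |nuOne τ| with hA
  have hA0 : 0 < A := by positivity
  have hsum : Summable (resTerm ν τ (4 * K) r) :=
    hs.of_nonneg_of_le (resTerm_nonneg _ _) (resTerm_le _ _)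
  rw [← mul_assoc, ← tsum_mul_left, ENNReal.ofReal_tsum_of_nonneg
    (fun k => mul_nonneg (by positivity) (resTerm_nonneg _ _ _)) (hsum.mul_left _),
    badUnion, Set.iUnion_inter]
  refine (measure_iUnion_le _).trans (ENNReal.tsum_le_tsum fun k => ?_)
  by_cases hk : N₀ ≤ |(k 0 : ℝ)|
  swap
  · simp [hk]
  have hk2 : 2 ≤ |(k 0 : ℝ)| := hN₀.trans hk
  have hkpos : 0 < |(k 0 : ℝ)| := by linarith
  have hksq : N₀ ^ 2 ≤ (k 0 : ℝ) ^ 2 := by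
    rw [← sq_abs (k 0 : ℝ)]
    gcongr
  have hk1 : 1 ≤ (k 0 : ℝ) ^ 2 := by nlinarith
  have hkR : 2 * R ≤ (k 0 : ℝ) ^ 2 * |nuOne τ| / 4 := hN₀R.trans (by gcongr)
  set J := m + Nat.sqrt (k 0).natAbs with hJ
  have hstep : volume ({ε | N₀ ≤ |(k 0 : ℝ)| ∧
      ε ∈ ⋃ j ∈ Finset.Icc 1 J, badSet ν τ nuT kaT r₁ c k j} ∩ Set.Icc 0 r) ≤
      (J : ℝ≥0∞) * ENNReal.ofReal (if |symbolL ν τ k| ≤ 4 * K * r ^ 2 * (k 0 : ℝ) ^ 2 then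
        A * r * (((k 0 : ℝ) ^ 2)⁻¹ * |symbolL ν τ k|⁻¹) else 0) := by
    have hsub : {ε | N₀ ≤ |(k 0 : ℝ)| ∧
        ε ∈ ⋃ j ∈ Finset.Icc 1 J, badSet ν τ nuT kaT r₁ c k j} ∩ Set.Icc 0 r ⊆
        ⋃ j ∈ Finset.Icc 1 J, (badSet ν τ nuT kaT r₁ c k j ∩ Set.Icc 0 r) := by
      rintro ε ⟨⟨-, h1⟩, h2⟩
      simp only [Set.mem_iUnion] at h1 ⊢
      obtain ⟨j, hj, h1⟩ := h1
      exact ⟨j, hj, h1, h2⟩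
    refine (measure_mono hsub).trans ((measure_biUnion_finset_le _ _).trans ?_)
    refine (Finset.sum_le_card_nsmul _ _ _ fun j hj => volume_badSet_inter_le hP hR hn hr₁ hr1 hrR
      hc hk1 hkR (hL k hk) (Finset.mem_Icc.1 hj).1 hr).trans (le_of_eq ?_)
    simp [hA, hK]
  refine hstep.trans ?_
  rw [← ENNReal.ofReal_natCast, ← ENNReal.ofReal_mul (by positivity)]
  apply ENNReal.ofReal_le_ofReal
  split_ifs with hres
  swap
  · rw [mul_zero]
    exact mul_nonneg (by positivity) (resTerm_nonneg _ _ _)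
  have hnear : k ∈ nearRes ν τ := by
    refine ⟨hk2, hres.trans ?_⟩
    gcongr
    exact le_trans (by gcongr) hrν
  have hterm : resTerm ν τ (4 * K) r k = |(k 0 : ℝ)| ^ (-(3 / 2) : ℝ) * |symbolL ν τ k|⁻¹ := by
    rw [resTerm, Set.indicator_of_mem (by exact hres), Set.indicator_of_mem hnear]
  have hJle : (J : ℝ) ≤ (m + 1) * |(k 0 : ℝ)| ^ (1 / 2 : ℝ) := by
    have h1 : ((Nat.sqrt (k 0).natAbs : ℕ) : ℝ) ≤ |(k 0 : ℝ)| ^ (1 / 2 : ℝ) := by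
      rw [← Real.sqrt_eq_rpow]
      refine Real.nat_sqrt_le_real_sqrt.trans (le_of_eq ?_)
      rw [Nat.cast_natAbs, Int.cast_abs]
    have h2 : 1 ≤ |(k 0 : ℝ)| ^ (1 / 2 : ℝ) := Real.one_le_rpow (by linarith) (by norm_num)
    rw [hJ]
    push_cast
    nlinarith [(Nat.cast_nonneg m : (0 : ℝ) ≤ m)]
  have hpow : |(k 0 : ℝ)| ^ (1 / 2 : ℝ) * ((k 0 : ℝ) ^ 2)⁻¹ = |(k 0 : ℝ)| ^ (-(3 / 2) : ℝ) := by
    rw [← sq_abs, ← Real.rpow_natCast, ← Real.rpow_neg hkpos.le, ← Real.rpow_add hkpos]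
    norm_num
  rw [hterm]
  calc (J : ℝ) * (A * r * (((k 0 : ℝ) ^ 2)⁻¹ * |symbolL ν τ k|⁻¹))
      ≤ ((m + 1) * |(k 0 : ℝ)| ^ (1 / 2 : ℝ)) *
        (A * r * (((k 0 : ℝ) ^ 2)⁻¹ * |symbolL ν τ k|⁻¹)) := by gcongr
    _ = r * ((m + 1) * A) * ((|(k 0 : ℝ)| ^ (1 / 2 : ℝ) * ((k 0 : ℝ) ^ 2)⁻¹) *
        |symbolL ν τ k|⁻¹) := by ring
    _ = _ := by rw [hpow]

end Bad

/-! ### Nondegeneracy of `ν₁` and the two lower bounds in `|k|`. -/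

theorem ae_polynomial_eval_ne_zero {p : Polynomial ℝ} (hp : p ≠ 0) :
    ∀ᵐ x : ℝ, p.eval x ≠ 0 := by
  have h : volume {x | p.IsRoot x} = 0 := (Polynomial.finite_setOfPred_isRoot hp).measure_zero _
  exact measure_eq_zero_iff_ae_notMem.1 h

/-- The numerator of `ν₁(τ)` as a polynomial in `ν₀`. -/
noncomputable def nuOnePoly : Polynomial ℝ :=
  (2 * .X - 1) * (4 * .X ^ 5 - 8 * .X ^ 4 + 8 * .X ^ 3 + 14 * .X ^ 2 - 4 * .X) - 9 * .X

theorem nuOnePoly_ne_zero : nuOnePoly ≠ 0 := by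
  intro h
  have := congrArg (Polynomial.eval 1) h
  norm_num [nuOnePoly] at this

/-- As `μ_c = 1/ν₀`, the coefficient is a rational function of `ν₀` with denominator `16 (2ν₀ - 1)`,
so it vanishes only at roots of one polynomial. -/
theorem nuOne_ne_zero {ν τ : ℝ} (hτ : 0 < τ) (hν : ν = √(1 + τ ^ 2))
    (h : nuOnePoly.eval ν ≠ 0) : nuOne τ ≠ 0 := by
  have hν1 := one_lt_nu hτ hν
  have h1 : (2 * ν - 1) ≠ 0 := by linarith
  have h2 : (2 : ℝ) - ν⁻¹ = (2 * ν - 1) / ν := by field_simp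
  have h3 : nuOne τ = nuOnePoly.eval ν / (16 * (2 * ν - 1)) := by
    unfold nuOne muC
    rw [← hν, h2]
    simp only [nuOnePoly, Polynomial.eval_sub, Polynomial.eval_add, Polynomial.eval_mul,
      Polynomial.eval_pow, Polynomial.eval_X, Polynomial.eval_ofNat, Polynomial.eval_one]
    obtain ⟨d, hd⟩ : ∃ d, d = 2 * ν - 1 := ⟨_, rfl⟩
    rw [← hd] at h1 ⊢
    field_simp
    rw [hd]
    ring
  rw [h3]
  exact div_ne_zero h (mul_ne_zero (by norm_num) h1)

theorem exists_le_symbolL_freqLength {α ν τ : ℝ} (hα : 0 < α) (hα1 : α ≤ 1) (hτ : 0 < τ)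
    (hν : ν = √(1 + τ ^ 2)) (h : IsDiophantine (α / 14) ν) :
    ∃ c : ℝ, 0 < c ∧ ∀ k, k ∉ kerFreq →
      c * (1 + freqLength k) ^ (-((1 + α) / 2)) ≤ |symbolL ν τ k - 0| := by
  have hν1 := one_lt_nu hτ hν
  obtain ⟨c, hc, hcb⟩ := exists_le_symbolL hα hα1 hτ hν h
  refine ⟨min 1 (c * 8 ^ (-((1 + α) / 2))), by positivity, fun k hk => ?_⟩
  rw [sub_zero]
  have hf := one_le_one_add_freqLength k
  rcases sq_le_or_symbolL_le hτ hν k with h1 | ⟨h1, h2⟩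
  · refine le_trans ?_ (hcb k hk)
    have h3 : 0 < 1 + |(k 0 : ℝ)| := by positivity
    have h4 := Real.rpow_le_rpow_of_nonpos (by positivity) h1
      (by linarith : -((1 + α) / 2) ≤ 0)
    rw [Real.mul_rpow (by norm_num) (by linarith), ← Real.rpow_natCast, ← Real.rpow_mul h3.le] at h4
    have h5 : ((2 : ℕ) : ℝ) * -((1 + α) / 2) = -(1 + α) := by
      push_cast
      ring
    rw [h5] at h4
    calc _ ≤ c * 8 ^ (-((1 + α) / 2)) * (1 + freqLength k) ^ (-((1 + α) / 2)) := by
          gcongr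
          exact min_le_right _ _
      _ = c * (8 ^ (-((1 + α) / 2)) * (1 + freqLength k) ^ (-((1 + α) / 2))) := by ring
      _ ≤ _ := by gcongr
  · calc _ ≤ (1 : ℝ) * 1 := by
          gcongr
          · exact min_le_left _ _
          · exact Real.rpow_le_one_of_one_le_of_nonpos hf (by linarith)
      _ ≤ -symbolL ν τ k := by
          rw [← sq_abs] at h2
          nlinarith
      _ ≤ _ := neg_le_abs _

/-- The perturbed symbol is bounded below by `c / (1 + |k|)` for most parameters `ε`. -/
theorem exists_le_pertSymbol {α ν τ R : ℝ} (hα : 0 < α) (hα1 : α ≤ 1) (hτ : 0 < τ)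
    (hν : ν = √(1 + τ ^ 2)) (h : IsDiophantine (α / 14) ν) (hn : nuOne τ ≠ 0) (hR : 0 < R) :
    ∃ c : ℝ, 0 < c ∧ ∀ r₀ : ℝ, 0 < r₀ → ∀ nuT kaT : ℕ → ℝ → ℝ,
      PerturbationBounds r₀ R nuT kaT → ∃ E : Set ℝ, E ⊆ Set.Ico 0 r₀ ∧ MeasurableSet E ∧
        Tendsto (fun r : ℝ => 2 / r ^ 2 * ∫ ε in Set.Icc 0 r ∩ E, ε) (𝓝[>] 0) (𝓝 1) ∧
        ∀ ε ∈ E, ∀ j : ℕ, 1 ≤ j → ∀ k, k ∉ kerFreq →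
          c * (1 + freqLength k) ^ (-1 : ℝ) ≤ |pertSymbol ν τ nuT kaT j ε k| := by
  have hν1 := one_lt_nu hτ hν
  have hn0 : 0 < |nuOne τ| := abs_pos.2 hn
  obtain ⟨a, ha, hab⟩ := exists_le_symbolL hα hα1 hτ hν h
  have hlow : ∀ k : Fin 2 → ℤ, k ∉ kerFreq → a / (1 + |(k 0 : ℝ)|) ^ 2 ≤ |symbolL ν τ k| := by
    intro k hk
    refine le_trans ?_ (hab k hk)
    have h1 : 1 ≤ 1 + |(k 0 : ℝ)| := by linarith [abs_nonneg (k 0 : ℝ)]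
    rw [div_eq_mul_inv, ← Real.rpow_natCast, ← Real.rpow_neg (by linarith)]
    gcongr
    · push_cast
      linarith
  -- Since `1 + |k₁| ≤ 2|k₁|`, this gives `4c/k₁² ≤ |L(k)|` for large `|k₁|`.
  set c := a / 16 with hc
  have hc0 : 0 < c := by positivity
  set K := |nuOne τ| + R with hK
  have hK0 : 0 < K := by positivity
  obtain ⟨N₀, hN₀⟩ : ∃ N₀, max 2 (8 * R / |nuOne τ|) ≤ N₀ := ⟨_, le_rfl⟩
  have hN2 : 2 ≤ N₀ := (le_max_left _ _).trans hN₀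
  have hN₀R : 2 * R ≤ N₀ ^ 2 * |nuOne τ| / 4 := by
    have h1 := (le_max_right _ _).trans hN₀
    rw [div_le_iff₀ hn0] at h1
    have h2 : N₀ * |nuOne τ| ≤ N₀ ^ 2 * |nuOne τ| := by
      gcongr
      nlinarith
    linarith
  obtain ⟨m, hm1, hm⟩ := exists_mul_pow_four_le_two_pow (by positivity : 0 < 2 * R / c)
  set b := a / (1 + N₀) ^ 2 with hb
  have hb0 : 0 < b := by positivity
  -- The bounds serve, in turn, to have `ε ≤ 1`, to control the cubic terms, to keep half of the
  -- symbol when `|k₁| < N₀`, and to force relevant frequencies into `nearRes`. None involves `r₀`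
  -- or the sequences, so neither does the final constant.
  set ρ := min (min 1 (|nuOne τ| / (12 * R))) (min (b / (2 * K * (1 + N₀ ^ 2)))
    (16 * K * (ν + 1))⁻¹) with hρ
  have hρ0 : 0 < ρ := by positivity
  refine ⟨min (b / 2) (min (c / 8) 1), by positivity, fun r₀ hr₀ nuT kaT hP => ?_⟩
  set r₁ := min r₀ ρ with hr₁
  have hr₁0 : 0 < r₁ := lt_min hr₀ hρ0
  have hle0 : r₁ ≤ r₀ := min_le_left _ _
  have hle1 : r₁ ≤ 1 := (min_le_right _ _).trans ((min_le_left _ _).trans (min_le_left _ _))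
  have hleR : r₁ ≤ |nuOne τ| / (12 * R) :=
    (min_le_right _ _).trans ((min_le_left _ _).trans (min_le_right _ _))
  have hleb : r₁ ≤ b / (2 * K * (1 + N₀ ^ 2)) :=
    (min_le_right _ _).trans ((min_le_right _ _).trans (min_le_left _ _))
  have hleν : r₁ ≤ (16 * K * (ν + 1))⁻¹ :=
    (min_le_right _ _).trans ((min_le_right _ _).trans (min_le_right _ _))
  have hrR : 3 * R * r₁ ≤ |nuOne τ| / 4 := by
    rw [le_div_iff₀ (by positivity)] at hleR
    linarith
  have hsq : r₁ ^ 2 ≤ r₁ := by nlinarith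
  have hrν : 4 * K * r₁ ^ 2 ≤ (4 * (ν + 1))⁻¹ := by
    calc 4 * K * r₁ ^ 2 ≤ 4 * K * (16 * K * (ν + 1))⁻¹ := by
          gcongr
          exact hsq.trans hleν
      _ = _ := by
          field_simp
          norm_num
  have hker : ∀ k : Fin 2 → ℤ, N₀ ≤ |(k 0 : ℝ)| → k ∉ kerFreq := by
    intro k hk hmem
    simp only [kerFreq, k0, k0star, Set.mem_insert_iff, Set.mem_singleton_iff] at hmem
    have hk2 := hN2.trans hk
    rcases hmem with rfl | rfl | rfl | rfl | rfl <;> norm_num at hk2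
  have hL : ∀ k : Fin 2 → ℤ, N₀ ≤ |(k 0 : ℝ)| → 4 * c / (k 0 : ℝ) ^ 2 ≤ |symbolL ν τ k| := by
    intro k hk
    refine le_trans ?_ (hlow k (hker k hk))
    have hk2 := hN2.trans hk
    rw [← sq_abs (k 0 : ℝ), hc, div_le_div_iff₀ (by positivity) (by positivity)]
    have h1 : (1 + |(k 0 : ℝ)|) ^ 2 ≤ (2 * |(k 0 : ℝ)|) ^ 2 := by
      gcongr
      linarith
    nlinarith
  have hs := summable_nearRes hα hα1 hτ hν h
  set B := badUnion ν τ nuT kaT r₁ c N₀ m with hB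
  refine ⟨Set.Ico 0 r₁ \ toMeasurable volume B, ?_, ?_, ?_, ?_⟩
  · exact Set.sdiff_subset.trans (Set.Ico_subset_Ico_right hle0)
  · exact measurableSet_Ico.diff (measurableSet_toMeasurable _ _)
  · refine tendsto_setIntegral_diff_toMeasurable hr₁0 ?_ fun r h1 h2 =>
      volume_badUnion_inter_le hP hR hn hle0 hle1 hrR hrν hc0 hN2 hN₀R hL hs h1 h2
    simpa using (tendsto_tsum_resTerm hs).const_mul _
  rintro ε ⟨⟨hε0, hε1⟩, hεB⟩ j hj k hk
  have hεB' : ε ∉ B := fun hmem => hεB (subset_toMeasurable _ _ hmem)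
  have hf := one_le_one_add_freqLength k
  have hfr : (1 + freqLength k) ^ (-1 : ℝ) ≤ 1 :=
    Real.rpow_le_one_of_one_le_of_nonpos hf (by norm_num)
  have hsub := abs_pertSymbol_sub_le (ν := ν) (τ := τ) hP hj hε0 (hε1.le.trans hle0)
    (hε1.le.trans hle1) k
  rw [← hK] at hsub
  have hεsq : ε ^ 2 ≤ r₁ := by nlinarith only [hε0, hε1, hle1]
  have hred : ∀ x : ℝ, min (b / 2) (min (c / 8) 1) ≤ x → x ≤ |pertSymbol ν τ nuT kaT j ε k| →
      min (b / 2) (min (c / 8) 1) * (1 + freqLength k) ^ (-1 : ℝ) ≤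
        |pertSymbol ν τ nuT kaT j ε k| := fun x h1 h2 =>
    (mul_le_of_le_one_right (by positivity) hfr).trans (h1.trans h2)
  rcases lt_or_ge |(k 0 : ℝ)| N₀ with hkN | hkN
  · refine hred (b / 2) (min_le_left _ _) ?_
    have h1 : b ≤ |symbolL ν τ k| := by
      refine le_trans ?_ (hlow k hk)
      rw [hb]
      gcongr
    have h2 : K * (1 + (k 0 : ℝ) ^ 2) * ε ^ 2 ≤ b / 2 :=
      calc K * (1 + (k 0 : ℝ) ^ 2) * ε ^ 2
          ≤ K * (1 + N₀ ^ 2) * (b / (2 * K * (1 + N₀ ^ 2))) := by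
            rw [← sq_abs (k 0 : ℝ)]
            gcongr
            exact hεsq.trans hleb
        _ = b / 2 := by field_simp
    have h3 := abs_sub_abs_le_abs_sub (symbolL ν τ k) (pertSymbol ν τ nuT kaT j ε k)
    rw [abs_sub_comm] at h3
    linarith only [h1, h2, h3, hsub]
  have hk2 := hN2.trans hkN
  have hk4 : 4 ≤ (k 0 : ℝ) ^ 2 := by
    rw [← sq_abs]
    nlinarith only [hk2]
  rcases sq_le_or_symbolL_le hτ hν k with h1 | ⟨-, h2⟩
  · have hgood : c / (k 0 : ℝ) ^ 2 ≤ |pertSymbol ν τ nuT kaT j ε k| := by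
      -- Indices up to `J` are good by exclusion; a later one differs from `J` by at most `c/k₁²`,
      -- half of the margin `2c/k₁²`.
      set J := m + Nat.sqrt (k 0).natAbs with hJ
      have hfin : ∀ i, 1 ≤ i → i ≤ J →
          2 * c / (k 0 : ℝ) ^ 2 ≤ |pertSymbol ν τ nuT kaT i ε k| := by
        intro i hi1 hi2
        by_contra! hlt
        refine hεB' (Set.mem_iUnion.2 ⟨k, hkN, ?_⟩)
        simp only [Set.mem_iUnion]
        exact ⟨i, Finset.mem_Icc.2 ⟨hi1, hi2⟩, ⟨hε0, hε1.le⟩, hlt⟩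
      have h2c : 2 * c / (k 0 : ℝ) ^ 2 = c / (k 0 : ℝ) ^ 2 + c / (k 0 : ℝ) ^ 2 := by ring
      have hcp : 0 < c / (k 0 : ℝ) ^ 2 := by positivity
      rcases le_or_gt j J with hjJ | hjJ
      · linarith only [hfin j hj hjJ, h2c, hcp]
      · have hJ1 : 1 ≤ J := hm1.trans (Nat.le_add_right _ _)
        have h3 := hfin J hJ1 le_rfl
        have h4 := abs_pertSymbol_sub_pertSymbol_le (ν := ν) (τ := τ) hP hR hJ1 hjJ.le hε0
          (hε1.le.trans hle0) (hε1.le.trans hle1) (by linarith only [hk4] : 1 ≤ (k 0 : ℝ) ^ 2)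
        have h5 : (k 0 : ℝ) ^ 2 * (2 * R / 2 ^ J) ≤ c / (k 0 : ℝ) ^ 2 := by
          have h6 := hm (k 0).natAbs
          rw [Nat.cast_natAbs, Int.cast_abs, ← hJ, div_mul_eq_mul_div, div_le_iff₀ hc0] at h6
          have h7 : |(k 0 : ℝ)| ^ 4 = (k 0 : ℝ) ^ 2 * (k 0 : ℝ) ^ 2 := by
            rw [← sq_abs (k 0 : ℝ)]
            ring
          rw [h7] at h6
          rw [← mul_div_assoc, div_le_div_iff₀ (by positivity) (by positivity)]
          linarith only [h6]
        have h6 := abs_sub_abs_le_abs_sub (pertSymbol ν τ nuT kaT J ε k)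
          (pertSymbol ν τ nuT kaT j ε k)
        rw [abs_sub_comm] at h6
        linarith only [h3, h4, h5, h6, h2c]
    refine le_trans ?_ hgood
    rw [Real.rpow_neg_one]
    calc min (b / 2) (min (c / 8) 1) * (1 + freqLength k)⁻¹
        ≤ c / 8 * (1 + freqLength k)⁻¹ := by
          gcongr
          exact (min_le_right _ _).trans (min_le_left _ _)
      _ = c / (8 * (1 + freqLength k)) := by field_simp
      _ ≤ c / (k 0 : ℝ) ^ 2 := by
          gcongr
          refine le_trans ?_ h1
          rw [← sq_abs]
          gcongr
          linarith only
  -- Here `L(k) ≤ -k₁²/2`, while the perturbation is at most `k₁²/8`, and `k₁² ≥ 4`.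
  · refine hred 1 ((min_le_right _ _).trans (min_le_right _ _)) (le_trans ?_ (neg_le_abs _))
    have h3 : K * (1 + (k 0 : ℝ) ^ 2) * ε ^ 2 ≤ (k 0 : ℝ) ^ 2 / 8 :=
      calc K * (1 + (k 0 : ℝ) ^ 2) * ε ^ 2
          ≤ K * (2 * (k 0 : ℝ) ^ 2) * (16 * K * (ν + 1))⁻¹ := by
            gcongr
            · linarith only [hk4]
            · exact hεsq.trans hleν
        _ = (k 0 : ℝ) ^ 2 / 8 * (ν + 1)⁻¹ := by
            field_simp
            ring
        _ ≤ (k 0 : ℝ) ^ 2 / 8 :=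
            mul_le_of_le_one_right (by positivity) (inv_le_one_of_one_le₀ (by linarith only [hν1]))
    have h4 := (le_abs_self _).trans hsub
    have h5 : (k 0 : ℝ) ^ 2 ≤ ν * (k 0 : ℝ) ^ 2 :=
      le_mul_of_one_le_left (sq_nonneg _) hν1.le
    linarith only [h2, h3, h4, h5, hk4]

/-! ### Assembling the theorem. -/

theorem span_expFun_image_kerFreq :
    Submodule.span ℂ (expFun '' kerFreq) =
      Submodule.span ℂ {expFun 0, expFun k0, expFun (-k0), expFun k0star, expFun (-k0star)} := by
  simp only [kerFreq, Set.image_insert_eq, Set.image_singleton]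

theorem expFun_k0_not_mem_span : expFun k0 ∉ Submodule.span ℂ {expFun 0} := by
  rw [Submodule.mem_span_singleton]
  rintro ⟨a, ha⟩
  have h := congrArg (fun u => fourierCoef u k0) ha
  have hne : k0 ≠ 0 := fun h => by simpa [k0] using congrFun h 0
  simp [fourierCoef_smul, fourierCoef_expFun, hne] at h

end SmallDivisor

open SmallDivisor in
theorem theorem4p2 (α : ℝ) (hα : 0 < α) (hα1 : α ≤ 1) :
    ∃ 𝔑 : Set ℝ, 𝔑 ⊆ Set.Ioi 1 ∧ volume (Set.Ioi (1 : ℝ) \ 𝔑) = 0 ∧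
      ∀ ν₀ ∈ 𝔑, ∀ τ : ℝ, 0 < τ → ν₀ = √(1 + τ ^ 2) →
        -- (a): the kernel of `𝔏₀`, and the loss of `(1 + α) / 2` derivatives
        ((∃ u ∈ kerL ν₀ τ, u ∉ Submodule.span ℂ {expFun 0}) ∧
          kerL ν₀ τ = Submodule.span ℂ {expFun 0, expFun k0, expFun (-k0),
            expFun k0star, expFun (-k0star)} ∧
          ∃ c : ℝ, 0 < c ∧ ∀ s : ℝ, ∀ u ∈ (kerL ν₀ τ)ᗮ, MemSobolev s u →
            ((1 + α) / 2 ≤ s → ∃ v ∈ (kerL ν₀ τ)ᗮ, Solves ν₀ τ 0 v u) ∧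
            (∀ v ∈ (kerL ν₀ τ)ᗮ, ∀ v' ∈ (kerL ν₀ τ)ᗮ,
              Solves ν₀ τ 0 v u → Solves ν₀ τ 0 v' u → v = v') ∧
            (∀ v ∈ (kerL ν₀ τ)ᗮ, Solves ν₀ τ 0 v u →
              MemSobolev (s - (1 + α) / 2) v ∧
              sobolevNorm (s - (1 + α) / 2) v ≤ c * sobolevNorm s u)) ∧
        -- (b): the resolvent for perturbed parameters
        (α < 1 / 78 → ∀ R : ℝ, 0 < R → ∃ c : ℝ, 0 < c ∧
          ∀ r₀ : ℝ, 0 < r₀ → ∀ nuT kaT : ℕ → ℝ → ℝ, PerturbationBounds r₀ R nuT kaT →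
            ∃ E : Set ℝ, E ⊆ Set.Ico 0 r₀ ∧ MeasurableSet E ∧
              Tendsto (fun r : ℝ => 2 / r ^ 2 * ∫ ε in Set.Icc 0 r ∩ E, ε) (𝓝[>] 0) (𝓝 1) ∧
              ∀ ε ∈ E, ∀ j : ℕ, 1 ≤ j → ∀ s : ℝ, 1 ≤ s →
                ∀ u ∈ (kerL ν₀ τ)ᗮ, MemSobolev s u →
                  ∃ v ∈ (kerL ν₀ τ)ᗮ,
                    Solves (nuPert ν₀ τ nuT j ε) τ (kaPert kaT j ε) v u ∧
                    (∀ v' ∈ (kerL ν₀ τ)ᗮ,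
                      Solves (nuPert ν₀ τ nuT j ε) τ (kaPert kaT j ε) v' u → v' = v) ∧
                    MemSobolev (s - 1) v ∧
                    sobolevNorm (s - 1) v ≤ c * sobolevNorm s u) := by
  -- The Diophantine condition serves both parts; the polynomial condition serves only (b), through
  -- `ν₁ ≠ 0`.
  refine ⟨{ν | 1 < ν ∧ IsDiophantine (α / 14) ν ∧ nuOnePoly.eval ν ≠ 0}, fun ν h => h.1, ?_, ?_⟩
  · have hae : ∀ᵐ ν : ℝ, IsDiophantine (α / 14) ν ∧ nuOnePoly.eval ν ≠ 0 :=
      (ae_isDiophantine (by linarith) (by linarith)).and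
        (ae_polynomial_eval_ne_zero nuOnePoly_ne_zero)
    refine measure_mono_null (fun ν hν => ?_) (ae_iff.1 hae)
    exact fun h => hν.2 ⟨hν.1, h⟩
  rintro ν ⟨-, hdio, hpoly⟩ τ hτ hν
  obtain ⟨c, hc, hcb⟩ := exists_le_symbolL_freqLength hα hα1 hτ hν hdio
  have hz : ∀ k ∈ kerFreq, symbolL ν τ k = 0 := fun k hk => symbolL_eq_zero_of_mem hν hk
  have hnz : ∀ k, k ∉ kerFreq → symbolL ν τ k ≠ 0 := by
    intro k hk
    simpa using symbol_sub_ne_zero hc hcb hk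
  have horth : ∀ u : L2, u ∈ (kerL ν τ)ᗮ ↔ ∀ k ∈ kerFreq, fourierCoef u k = 0 := fun u =>
    mem_orthogonal_kerL_iff hz hnz
  simp only [horth]
  refine ⟨⟨⟨expFun k0, expFun_mem_kerL (hz k0 (by simp [kerFreq])), expFun_k0_not_mem_span⟩, ?_,
    c⁻¹, inv_pos.2 hc, fun s u hu hsu => ⟨fun hs => exists_solves hc hcb hs hsu hu,
      fun v hv v' hv' h h' => Solves.unique hc hcb hv hv' h h',
      fun v hv h => Solves.sobolev_bound hc hcb hsu hv h⟩⟩, ?_⟩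
  · rw [kerL_eq_span_image hz hnz, span_expFun_image_kerFreq]
  · intro _ R hR
    obtain ⟨d, hd, hE⟩ := exists_le_pertSymbol hα hα1 hτ hν hdio (nuOne_ne_zero hτ hν hpoly) hR
    refine ⟨d⁻¹, inv_pos.2 hd, fun r₀ hr₀ nuT kaT hP => ?_⟩
    obtain ⟨E, hE1, hE2, hE3, hE4⟩ := hE r₀ hr₀ nuT kaT hP
    refine ⟨E, hE1, hE2, hE3, fun ε hε j hj s hs u hu hsu => ?_⟩
    have hb := hE4 ε hε j hj
    obtain ⟨v, hv, hsol⟩ := exists_solves hd hb hs hsu hu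
    exact ⟨v, hv, hsol, fun v' hv' h' => Solves.unique hd hb hv' hv h' hsol,
      Solves.sobolev_bound hd hb hsu hv hsol⟩
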